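/- Let $A$ be an $s\times t$ binary matrix, i.e. a matrix with entries in $\{0,1\}$. A copy of $A$ in an $n\times n$ binary matrix $M$ is an $s\times t$ submatrix of $M$ equal to $A$, where a submatrix is obtained by deleting rows and columns, the order of the remaining ones being preserved, and is identified by the sets of $s$ rows and $t$ columns that it occupies. Copies of $A$ are pairwise disjoint if every entry (position) of $M$ is contained in at most one of them. There is a real polynomial $P$, depending only on $A$, such that for every $\epsilon>0$ there is $\delta>0$ with $\delta^{-1}=P(\epsilon^{-1})$ for which the following holds for every $n$ and every $n\times n$ binary matrix $M$: if $M$ contains at least $\epsilon n^2$ pairwise disjoint copies of $A$, then the total number of copies of $A$ in $M$ is at least $\delta n^{s+t}$. -/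

import Mathlib

/-- The position of an `s × t` submatrix of an `m × n` matrix: the strictly increasing list of the
`s` rows that are kept together with the strictly increasing list of the `t` columns that are
kept. Two submatrices are the same if and only if they occupy the same rows and columns. -/
abbrev SubmatrixPos (s t m n : ℕ) : Type :=
  (Fin s ↪o Fin m) × (Fin t ↪o Fin n)

/-- The set of entries of the ambient `m × n` matrix that a submatrix contains. -/
def SubmatrixPos.entries {s t m n : ℕ} (S : SubmatrixPos s t m n) : Set (Fin m × Fin n) :=
  Set.range S.1 ×ˢ Set.range S.2

/-- The set of all copies of `A` in `M`: the (order-preserving) submatrices of `M` equal to `A`. -/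
def copies {Γ : Type*} {s t m n : ℕ} (A : Matrix (Fin s) (Fin t) Γ)
    (M : Matrix (Fin m) (Fin n) Γ) : Set (SubmatrixPos s t m n) :=
  {S | M.submatrix S.1 S.2 = A}

/-- The set of copies is finite, so that counting it with `Set.ncard` is meaningful. -/
theorem copies_finite {Γ : Type*} {s t m n : ℕ} (A : Matrix (Fin s) (Fin t) Γ)
    (M : Matrix (Fin m) (Fin n) Γ) : (copies A M).Finite := by
  have h1 : Finite (Fin s ↪o Fin m) := DFunLike.finite _
  have h2 : Finite (Fin t ↪o Fin n) := DFunLike.finite _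
  exact Set.toFinite _

/-! Take an integer `N ≥ 1/ε` and suppose that `A` has few copies. If the rows of `M` realise every
0/1 pattern on `s! * t + s` columns, then `A` occurs there. By Sauer–Shelah, a copy-free sample of
`q` columns therefore shows only polynomially many row patterns (`exists_copy_or_card_le`). A random
sample is usually copy-free and separates its rows that differ in more than a `1/N` fraction of the
columns, so almost all rows are close to one of poly(`N`) rows (`many_copies_or_exists_row_net`).
The same for columns, followed by a majority vote, makes `M` agree up to few entries with `f (i r)
(j c)`, where `i` and `j` take poly(`N`) values (`many_copies_or_exists_block_approx`).

It remains to turn one copy into many without destroying the order. The classes of `i` may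
interleave, so a row cannot be replaced by an arbitrary row of its class. Instead `i` is refined
repeatedly, one level per row of `A`: the next level records how many initial segments of current
classes have already ended. Consecutive rows of a copy can then be moved independently into the
initial segments of their classes at consecutive levels (`exists_ordered_refinements`).

Call an entry bad if it violates the approximation, lies in an exceptional row or column, or lies in
a block dense in violations. Disjoint copies outnumber bad entries, so some copy avoids them. Moving
its rows and columns inside their initial segments gives a polynomially small proportion of all
choices, and at least half of these are copies (`many_copies_of_block_approx`). -/

/-! ### Polynomially bounded functions -/

/-- A function on the natural numbers that is bounded by a polynomial. -/
def PolyBounded (F : ℕ → ℕ) : Prop := ∃ C k : ℕ, ∀ N, F N ≤ C * (N + 1) ^ k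

namespace PolyBounded

theorem const (c : ℕ) : PolyBounded fun _ => c := ⟨c, 0, fun N => by simp⟩

theorem id : PolyBounded fun N => N := ⟨1, 1, fun N => by simp⟩

theorem add {F G : ℕ → ℕ} (hF : PolyBounded F) (hG : PolyBounded G) :
    PolyBounded fun N => F N + G N := by
  obtain ⟨C, k, h⟩ := hF
  obtain ⟨C', k', h'⟩ := hG
  refine ⟨C + C', k + k', fun N => ?_⟩
  have h1 : (N + 1) ^ k ≤ (N + 1) ^ (k + k') := Nat.pow_le_pow_right (by omega) (by omega)
  have h2 : (N + 1) ^ k' ≤ (N + 1) ^ (k + k') := Nat.pow_le_pow_right (by omega) (by omega)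
  calc F N + G N ≤ C * (N + 1) ^ k + C' * (N + 1) ^ k' := add_le_add (h N) (h' N)
    _ ≤ C * (N + 1) ^ (k + k') + C' * (N + 1) ^ (k + k') := by gcongr
    _ = _ := by ring

theorem mul {F G : ℕ → ℕ} (hF : PolyBounded F) (hG : PolyBounded G) :
    PolyBounded fun N => F N * G N := by
  obtain ⟨C, k, h⟩ := hF
  obtain ⟨C', k', h'⟩ := hG
  refine ⟨C * C', k + k', fun N => ?_⟩
  calc F N * G N ≤ C * (N + 1) ^ k * (C' * (N + 1) ^ k') := Nat.mul_le_mul (h N) (h' N)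
    _ = _ := by ring

theorem pow {F : ℕ → ℕ} (hF : PolyBounded F) (e : ℕ) : PolyBounded fun N => F N ^ e := by
  induction e with
  | zero => simpa using const 1
  | succ e ih => simpa only [pow_succ] using ih.mul hF

theorem comp {F G : ℕ → ℕ} (hF : PolyBounded F) (hG : PolyBounded G) :
    PolyBounded fun N => F (G N) := by
  obtain ⟨C, k, h⟩ := hF
  obtain ⟨C', k', h'⟩ := ((const C).mul ((hG.add (const 1)).pow k))
  exact ⟨C', k', fun N => (h (G N)).trans (h' N)⟩

end PolyBounded

/-! ### Shattered columns and copies -/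

/-- If the entries of `M` in the rows from `X` realise all binary patterns on `s! * t + s` columns,
then every `s × t` matrix has a copy in these rows and columns. -/
theorem exists_copy_of_all_patterns {s t m n : ℕ} (A : Matrix (Fin s) (Fin t) (Fin 2))
    (M : Matrix (Fin m) (Fin n) (Fin 2)) (X : Set (Fin m))
    (e : Fin (Fintype.card (Equiv.Perm (Fin s)) * t + s) ↪o Fin n)
    (h : ∀ u : Fin (Fintype.card (Equiv.Perm (Fin s)) * t + s) → Fin 2,
      ∃ r ∈ X, ∀ d, M r (e d) = u d) :
    ∃ S ∈ copies A M, Set.range S.1 ⊆ X ∧ Set.range S.2 ⊆ Set.range e := by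
  classical
  let E := Fintype.equivFin (Equiv.Perm (Fin s))
  -- One block of `t` columns per permutation, holding `A` with its rows permuted, and a final
  -- identity block that forces the chosen rows to be distinct. Whatever permutation sorts these
  -- rows, its own block shows `A` in the right order.
  let u : Fin s → Fin (Fintype.card (Equiv.Perm (Fin s)) * t + s) → Fin 2 := fun a =>
    Fin.addCases
      (fun d => A ((E.symm (finProdFinEquiv.symm d).1).symm a) (finProdFinEquiv.symm d).2)
      (fun a' => if a = a' then 1 else 0)
  choose r hrX hr using fun a => h (u a)
  have hinj : Function.Injective r := by
    intro a a' haa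
    have h1 := hr a (Fin.natAdd _ a)
    have h2 := hr a' (Fin.natAdd _ a)
    rw [haa, h2] at h1
    by_contra hne
    simp [u, Ne.symm hne] at h1
  let σ := Tuple.sort r
  have hmono : StrictMono (r ∘ σ) :=
    (Tuple.monotone_sort r).strictMono_of_injective (hinj.comp σ.injective)
  have hcol : StrictMono fun b : Fin t =>
      e (Fin.castAdd s (finProdFinEquiv (E σ, b))) := by
    intro b b' hbb
    apply e.strictMono
    rw [Fin.lt_def]
    simpa using hbb
  refine ⟨(OrderEmbedding.ofStrictMono _ hmono, OrderEmbedding.ofStrictMono _ hcol), ?_, ?_, ?_⟩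
  · show M.submatrix _ _ = A
    funext a b
    show M (r (σ a)) (e _) = A a b
    rw [hr]
    simp only [u, Fin.addCases_left, Equiv.symm_apply_apply]
  · rintro _ ⟨a, rfl⟩
    exact hrX _
  · rintro _ ⟨b, rfl⟩
    exact ⟨_, rfl⟩

/-- A set with fewer than `D` elements is encoded by `D` slots, each empty or holding an element. -/
theorem card_filter_card_lt_le (q D : ℕ) :
    (Finset.univ.filter fun S : Finset (Fin q) => S.card < D).card ≤ (q + 1) ^ D := by
  classical
  have : (Finset.univ.filter fun S : Finset (Fin q) => S.card < D) ⊆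
      (Finset.univ : Finset (Fin D → Option (Fin q))).image
        (fun f => Finset.univ.filter fun i => ∃ d, f d = some i) := by
    intro S hS
    simp only [Finset.mem_filter, Finset.mem_univ, true_and] at hS
    simp only [Finset.mem_image, Finset.mem_univ, true_and]
    refine ⟨fun d => if h : d.1 < S.card then some (S.equivFin.symm ⟨d, h⟩).1 else none, ?_⟩
    ext i
    simp only [Finset.mem_filter, Finset.mem_univ, true_and]
    constructor
    · rintro ⟨d, hd⟩
      split_ifs at hd with h
      simp only [Option.some.injEq] at hd
      rw [← hd]
      exact Subtype.prop _
    · intro hi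
      refine ⟨⟨S.equivFin ⟨i, hi⟩, (Fin.is_lt _).trans hS⟩, ?_⟩
      simp
  refine (Finset.card_le_card this).trans (Finset.card_image_le.trans ?_)
  simp

/-- Sauer–Shelah for matrices: in the rows `x` and columns `y`, either there is a copy of `A`,
or a set of rows with pairwise different patterns is polynomially small in the number of
columns. -/
theorem exists_copy_or_card_le {s t m n p q : ℕ} (A : Matrix (Fin s) (Fin t) (Fin 2))
    (M : Matrix (Fin m) (Fin n) (Fin 2)) (x : Fin p → Fin m) (y : Fin q → Fin n)
    (I : Finset (Fin p)) (hI : ∀ k ∈ I, ∀ k' ∈ I, (∀ l, M (x k) (y l) = M (x k') (y l)) → k = k') :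
    (∃ S ∈ copies A M, Set.range S.1 ⊆ Set.range x ∧ Set.range S.2 ⊆ Set.range y) ∨
      I.card ≤ (q + 1) ^ (Fintype.card (Equiv.Perm (Fin s)) * t + s) := by
  classical
  set D := Fintype.card (Equiv.Perm (Fin s)) * t + s with hD
  let pat : Fin p → Finset (Fin q) := fun k => Finset.univ.filter fun l => M (x k) (y l) = 1
  have hfin2 : ∀ a b : Fin 2, (a = 1 ↔ b = 1) → a = b := by decide
  have hcard : I.card = (I.image pat).card := by
    rw [Finset.card_image_of_injOn]
    intro k hk k' hk' hkk
    refine hI k hk k' hk' fun l => hfin2 _ _ ?_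
    have := congrArg (fun S => l ∈ S) hkk
    simpa [pat] using this
  by_cases hsh : ∃ S : Finset (Fin q), (I.image pat).Shatters S ∧ D ≤ S.card
  · left
    obtain ⟨S, hS, hDS⟩ := hsh
    -- The sample may repeat columns, but equal columns cannot be told apart by any pattern, so a
    -- shattered set contains no repetition.
    have hyinj : Set.InjOn y S := by
      intro l hl l' hl' hll
      obtain ⟨u, hu, hu'⟩ := hS.exists_inter_eq_singleton hl
      obtain ⟨k, -, rfl⟩ := Finset.mem_image.1 hu
      have h1 : l ∈ S ∩ pat k := by rw [hu']; simp
      have h2 : l' ∈ S ∩ pat k := by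
        simp only [pat, Finset.mem_inter, Finset.mem_filter, Finset.mem_univ, true_and] at h1 ⊢
        exact ⟨hl', hll ▸ h1.2⟩
      rw [hu', Finset.mem_singleton] at h2
      exact h2.symm
    have hDS' : D ≤ (S.image y).card := by rwa [Finset.card_image_of_injOn hyinj]
    let e := (S.image y).orderEmbOfCardLe hDS'
    have he : ∀ d, ∃ l ∈ S, y l = e d := fun d =>
      Finset.mem_image.1 (Finset.orderEmbOfCardLe_mem _ hDS' d)
    obtain ⟨T, hT, h1, h2⟩ := exists_copy_of_all_patterns A M (Set.range x) e (by
      intro u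
      choose l hlS hl using he
      obtain ⟨v, hv, hv'⟩ := hS (t := S.filter fun i => ∃ d, e d = y i ∧ u d = 1)
        (Finset.filter_subset _ _)
      obtain ⟨k, -, rfl⟩ := Finset.mem_image.1 hv
      refine ⟨x k, ⟨k, rfl⟩, fun d => hfin2 _ _ ?_⟩
      have := congrArg (fun S => l d ∈ S) hv'
      simp only [pat, Finset.mem_inter, Finset.mem_filter, Finset.mem_univ, true_and, hlS, hl,
        eq_iff_iff] at this
      rw [this]
      constructor
      · rintro ⟨d', hd, hu⟩
        rwa [← e.injective hd]
      · intro hu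
        exact ⟨d, rfl, hu⟩)
    refine ⟨T, hT, h1, h2.trans ?_⟩
    rintro _ ⟨d, rfl⟩
    obtain ⟨l, -, hl⟩ := he d
    exact ⟨l, hl⟩
  · right
    push Not at hsh
    rw [hcard]
    -- Pajor's form of Sauer–Shelah: a family has at most as many members as it shatters sets.
    refine (Finset.card_le_card_shatterer _).trans ((Finset.card_le_card ?_).trans
      (card_filter_card_lt_le q D))
    intro S hS
    simp only [Finset.mem_filter, Finset.mem_univ, true_and]
    exact hsh S (Finset.mem_shatterer.1 hS)

/-! ### Sampling estimates -/

/-- A random tuple takes prescribed values at `s` distinct places with probability at most `n ^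
(-s)`: overwriting those places by arbitrary values is injective. -/
theorem pow_mul_card_filter_comp_eq_le {s p n : ℕ} {α : Fin s → Fin p} (hα : Function.Injective α)
    (ρ : Fin s → Fin n) :
    n ^ s * (Finset.univ.filter fun x : Fin p → Fin n => x ∘ α = ρ).card ≤ n ^ p := by
  classical
  have h1 : n ^ s = (Finset.univ : Finset (Fin s → Fin n)).card := by simp
  have h2 : n ^ p = (Finset.univ : Finset (Fin p → Fin n)).card := by simp
  rw [h1, h2, ← Finset.card_product]
  refine Finset.card_le_card_of_injOn (fun z => Function.extend α z.1 z.2)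
    (fun _ _ => Finset.mem_coe.2 (Finset.mem_univ _)) ?_
  rintro ⟨ρ₁, x₁⟩ h₁ ⟨ρ₂, x₂⟩ h₂ h
  simp only [Finset.coe_product, Finset.coe_filter, Finset.mem_univ, true_and, Set.mem_prod,
    Set.mem_ofPred_eq] at h₁ h₂
  have key : ∀ i, Function.extend α ρ₁ x₁ i = Function.extend α ρ₂ x₂ i := fun i => congrFun h i
  have hρ : ρ₁ = ρ₂ := by
    funext a
    simpa [hα.extend_apply] using key (α a)
  have hx : x₁ = x₂ := by
    funext i
    by_cases hi : ∃ a, α a = i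
    · obtain ⟨a, rfl⟩ := hi
      exact congrFun (h₁.2.trans h₂.2.symm) a
    · simpa [Function.extend_apply' _ _ _ hi] using key i
  rw [hρ, hx]

/-- If a fixed proportion of the samples of `p` rows and `q` columns contains a copy of `A`, then
`A` has many copies. -/
theorem card_sample_contains_copy_le {s t p q m n : ℕ} (A : Matrix (Fin s) (Fin t) (Fin 2))
    (M : Matrix (Fin m) (Fin n) (Fin 2)) (T : Finset ((Fin p → Fin m) × (Fin q → Fin n)))
    (hT : ∀ z ∈ T, ∃ S ∈ copies A M, Set.range S.1 ⊆ Set.range z.1 ∧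
      Set.range S.2 ⊆ Set.range z.2) :
    m ^ s * n ^ t * T.card ≤ p ^ s * q ^ t * (copies A M).ncard * (m ^ p * n ^ q) := by
  classical
  set C := (copies_finite A M).toFinset with hC
  have hCcard : (copies A M).ncard = C.card := Set.ncard_eq_toFinset_card _ _
  -- Union bound over the copy and the places in the sample at which its rows and columns appear.
  let Idx : Finset (((Fin s → Fin p) × (Fin t → Fin q)) × SubmatrixPos s t m n) :=
    (Finset.univ ×ˢ C).filter fun w => Function.Injective w.1.1 ∧ Function.Injective w.1.2
  have hsub : T ⊆ Idx.biUnion fun w =>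
      (Finset.univ.filter fun x : Fin p → Fin m => x ∘ w.1.1 = w.2.1) ×ˢ
      (Finset.univ.filter fun y : Fin q → Fin n => y ∘ w.1.2 = w.2.2) := by
    intro z hz
    obtain ⟨S, hS, h1, h2⟩ := hT z hz
    choose α hα using fun a => h1 ⟨a, rfl⟩
    choose β hβ using fun b => h2 ⟨b, rfl⟩
    refine Finset.mem_biUnion.2 ⟨((α, β), S), ?_, ?_⟩
    · simp only [Idx, Finset.mem_filter, Finset.mem_product, Finset.mem_univ, true_and]
      refine ⟨by simpa [hC] using hS, fun a a' h => ?_, fun b b' h => ?_⟩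
      · exact S.1.injective (by rw [← hα, ← hα, h])
      · exact S.2.injective (by rw [← hβ, ← hβ, h])
    · simp only [Finset.mem_product, Finset.mem_filter, Finset.mem_univ, true_and]
      exact ⟨funext hα, funext hβ⟩
  have hIdx : Idx.card ≤ p ^ s * q ^ t * C.card := by
    refine (Finset.card_filter_le _ _).trans ?_
    simp [Finset.card_product]
  calc m ^ s * n ^ t * T.card
      ≤ m ^ s * n ^ t * ∑ w ∈ Idx,
        ((Finset.univ.filter fun x : Fin p → Fin m => x ∘ w.1.1 = w.2.1) ×ˢ
        (Finset.univ.filter fun y : Fin q → Fin n => y ∘ w.1.2 = w.2.2)).card := by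
        gcongr
        exact (Finset.card_le_card hsub).trans Finset.card_biUnion_le
    _ = ∑ w ∈ Idx, m ^ s * n ^ t *
        ((Finset.univ.filter fun x : Fin p → Fin m => x ∘ w.1.1 = w.2.1) ×ˢ
        (Finset.univ.filter fun y : Fin q → Fin n => y ∘ w.1.2 = w.2.2)).card := by
        rw [Finset.mul_sum]
    _ ≤ ∑ w ∈ Idx, m ^ p * n ^ q := by
        refine Finset.sum_le_sum fun w hw => ?_
        simp only [Idx, Finset.mem_filter] at hw
        rw [Finset.card_product]
        calc _ = m ^ s * (Finset.univ.filter fun x : Fin p → Fin m => x ∘ w.1.1 = w.2.1).card *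
              (n ^ t * (Finset.univ.filter fun y : Fin q → Fin n => y ∘ w.1.2 = w.2.2).card) := by
              ring
          _ ≤ _ := Nat.mul_le_mul (pow_mul_card_filter_comp_eq_le hw.2.1 _)
              (pow_mul_card_filter_comp_eq_le hw.2.2 _)
    _ = Idx.card * (m ^ p * n ^ q) := by rw [Finset.sum_const, smul_eq_mul]
    _ ≤ _ := by rw [hCcard]; gcongr

theorem pow_mul_add_le_mul_succ_pow (k j : ℕ) : k ^ j * (k + j) ≤ k * (k + 1) ^ j := by
  induction j with
  | zero => simp
  | succ j ih =>
    calc k ^ (j + 1) * (k + (j + 1)) ≤ (k + 1) * (k ^ j * (k + j)) := by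
          rw [pow_succ]
          nlinarith [Nat.zero_le (k ^ j * j)]
      _ ≤ (k + 1) * (k * (k + 1) ^ j) := by gcongr
      _ = _ := by ring

/-- `(1 - 1/N) ^ N ≤ 1/2`, from Bernoulli's inequality. -/
theorem two_mul_pred_pow_le {N : ℕ} (hN : 1 ≤ N) : 2 * (N - 1) ^ N ≤ N ^ N := by
  obtain ⟨k, rfl⟩ : ∃ k, N = k + 1 := ⟨N - 1, by omega⟩
  rw [Nat.add_sub_cancel]
  rcases Nat.eq_zero_or_pos k with rfl | hk
  · simp
  · refine Nat.le_of_mul_le_mul_left (le_trans ?_ (pow_mul_add_le_mul_succ_pow k (k + 1))) hk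
    nlinarith [Nat.zero_le (k ^ (k + 1))]

/-- A linear multiple of `N ^ 2` samples detects an event of probability `1 / N` except with
polynomially small probability. -/
theorem exists_sample_size (D : ℕ) : ∃ c : ℕ, ∀ N : ℕ, 1 ≤ N →
    3 * N * ((3 * N * (c * N ^ 2 + 1) ^ D) ^ 2 * (N - 1) ^ (c * N ^ 2)) ≤ N ^ (c * N ^ 2) := by
  -- With `c = 2 ^ e` the failure probability is at most `2 ^ (-c * N)`, while the other factors are
  -- at most `2 ^ ((9 + 2 * D * (e + 3)) * N)`.
  obtain ⟨e, hsq⟩ : ∃ e, 9 + 2 * D * (e + 3) ≤ 2 ^ e := by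
    obtain ⟨X, hX⟩ : ∃ X, X = 2 * D + 8 := ⟨_, rfl⟩
    refine ⟨3 * X, ?_⟩
    have h1 : X ≤ 2 ^ X := Nat.lt_two_pow_self.le
    have h2 : X * X * X ≤ 2 ^ (3 * X) := by
      calc X * X * X ≤ 2 ^ X * 2 ^ X * 2 ^ X := by gcongr
        _ = _ := by ring
    refine le_trans ?_ h2
    have hD : 2 * D ≤ X := by omega
    have h8 : 8 ≤ X := by omega
    have h9 : 2 * D * (3 * X + 3) ≤ X * (3 * X + 3) := by gcongr
    nlinarith [Nat.mul_le_mul_right (X * X) h8, Nat.mul_le_mul_right X h8]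
  refine ⟨2 ^ e, fun N hN => ?_⟩
  have hN2 : N ≤ 2 ^ N := Nat.lt_two_pow_self.le
  have h2 : 2 ^ (2 ^ e * N) * (N - 1) ^ (2 ^ e * N ^ 2) ≤ N ^ (2 ^ e * N ^ 2) := by
    have := Nat.pow_le_pow_left (two_mul_pred_pow_le hN) (2 ^ e * N)
    rw [mul_pow, ← pow_mul, ← pow_mul] at this
    convert this using 2 <;> ring_nf
  refine le_trans ?_ h2
  rw [← mul_assoc]
  gcongr
  have h3 : 2 ^ e * N ^ 2 + 1 ≤ 2 ^ (e + 1 + 2 * N) := by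
    have : N ^ 2 ≤ 2 ^ (2 * N) := by
      rw [Nat.mul_comm, pow_mul]; gcongr
    have h5 : 1 ≤ 2 ^ e * 2 ^ (2 * N) := Nat.one_le_iff_ne_zero.2 (by positivity)
    calc 2 ^ e * N ^ 2 + 1 ≤ 2 ^ e * 2 ^ (2 * N) + 2 ^ e * 2 ^ (2 * N) := by gcongr
      _ = _ := by ring
  calc 3 * N * (3 * N * (2 ^ e * N ^ 2 + 1) ^ D) ^ 2
      ≤ 2 ^ 2 * 2 ^ N * (2 ^ 2 * 2 ^ N * (2 ^ (e + 1 + 2 * N)) ^ D) ^ 2 := by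
        gcongr <;> norm_num
    _ = 2 ^ (6 + 3 * N + 2 * D * (e + 1 + 2 * N)) := by ring
    _ ≤ 2 ^ (2 ^ e * N) := by
        apply Nat.pow_le_pow_right (by norm_num)
        calc 6 + 3 * N + 2 * D * (e + 1 + 2 * N)
            ≤ 6 * N + 3 * N + 2 * D * (e * N + N + 2 * N) := by
              have h6 : e ≤ e * N := Nat.le_mul_of_pos_right _ hN
              have h7 : 2 * D * (e + 1 + 2 * N) ≤ 2 * D * (e * N + N + 2 * N) := by gcongr
              omega
          _ = (9 + 2 * D * (e + 3)) * N := by ring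
          _ ≤ 2 ^ e * N := by gcongr

/-- The rows `r` and `r'` of `M` differ in more than a `1 / N` fraction of the columns. -/
def FarRows {Γ : Type*} [DecidableEq Γ] {m n : ℕ} (N : ℕ) (M : Matrix (Fin m) (Fin n) Γ)
    (r r' : Fin m) : Prop :=
  n < N * (Finset.univ.filter fun c => M r c ≠ M r' c).card

theorem FarRows.card_agree_le {Γ : Type*} [DecidableEq Γ] {m n N : ℕ}
    {M : Matrix (Fin m) (Fin n) Γ} {r r' : Fin m} (h : FarRows N M r r') (q : ℕ) :
    N ^ q * (Finset.univ.filter fun y : Fin q → Fin n => ∀ l, M r (y l) = M r' (y l)).card ≤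
      (N - 1) ^ q * n ^ q := by
  classical
  have h1 : (Finset.univ.filter fun y : Fin q → Fin n => ∀ l, M r (y l) = M r' (y l)) =
      Fintype.piFinset fun _ => Finset.univ.filter fun c => M r c = M r' c := by
    ext y
    simp
  have h2 := Finset.card_filter_add_card_filter_not (s := (Finset.univ : Finset (Fin n)))
    (fun c => M r c = M r' c)
  rw [Finset.card_univ, Fintype.card_fin] at h2
  rw [h1, Fintype.card_piFinset_const, ← mul_pow, ← mul_pow]
  apply Nat.pow_le_pow_left
  unfold FarRows at h
  obtain ⟨k, rfl⟩ : ∃ k, N = k + 1 := ⟨N - 1, by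
    have : N ≠ 0 := by rintro rfl; simp at h
    omega⟩
  simp only [ne_eq, Nat.add_sub_cancel] at *
  nlinarith

/-- Union bound over the `p ^ 2` pairs of sampled rows: a far pair agrees on all `q` random columns
with probability at most `(1 - 1/N) ^ q`. -/
theorem card_not_separated_le {Γ : Type*} [DecidableEq Γ] {m n N p q : ℕ}
    (M : Matrix (Fin m) (Fin n) Γ) (Z : Finset ((Fin p → Fin m) × (Fin q → Fin n)))
    (hZ : ∀ z ∈ Z, ∃ k k', FarRows N M (z.1 k) (z.1 k') ∧
      ∀ l, M (z.1 k) (z.2 l) = M (z.1 k') (z.2 l)) :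
    N ^ q * Z.card ≤ p ^ 2 * (N - 1) ^ q * (m ^ p * n ^ q) := by
  classical
  let W : Fin p × Fin p → Finset ((Fin p → Fin m) × (Fin q → Fin n)) := fun k =>
    Finset.univ.filter fun z => FarRows N M (z.1 k.1) (z.1 k.2) ∧
      ∀ l, M (z.1 k.1) (z.2 l) = M (z.1 k.2) (z.2 l)
  have hsub : Z ⊆ Finset.univ.biUnion W := by
    intro z hz
    obtain ⟨k, k', h⟩ := hZ z hz
    exact Finset.mem_biUnion.2 ⟨(k, k'), Finset.mem_univ _, by simpa [W] using h⟩
  have hW : ∀ k, N ^ q * (W k).card ≤ (N - 1) ^ q * (m ^ p * n ^ q) := by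
    intro k
    have h1 : (W k).card = ∑ x : Fin p → Fin m, (Finset.univ.filter fun y : Fin q → Fin n =>
        FarRows N M (x k.1) (x k.2) ∧ ∀ l, M (x k.1) (y l) = M (x k.2) (y l)).card := by
      simp only [W, Finset.card_filter, Fintype.sum_prod_type]
    rw [h1, Finset.mul_sum]
    calc _ ≤ ∑ x : Fin p → Fin m, (N - 1) ^ q * n ^ q := by
          refine Finset.sum_le_sum fun x _ => ?_
          by_cases hf : FarRows N M (x k.1) (x k.2)
          · simpa only [hf, true_and] using hf.card_agree_le q
          · simp [hf]
      _ = _ := by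
          rw [Finset.sum_const, Finset.card_univ, smul_eq_mul]
          simp only [Fintype.card_fun, Fintype.card_fin]
          ring
  calc N ^ q * Z.card ≤ N ^ q * ∑ k, (W k).card := by
        gcongr
        exact (Finset.card_le_card hsub).trans Finset.card_biUnion_le
    _ = ∑ k, N ^ q * (W k).card := by rw [Finset.mul_sum]
    _ ≤ ∑ k : Fin p × Fin p, (N - 1) ^ q * (m ^ p * n ^ q) := Finset.sum_le_sum fun k _ => hW k
    _ = _ := by
        rw [Finset.sum_const, Finset.card_univ, smul_eq_mul]
        simp only [Fintype.card_prod, Fintype.card_fin]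
        ring

/-! ### Approximation by few rows and columns -/

/-- Averaging over samples: if on average few of the members of a sample of `p + 1` rows are far
from all the others, then some `p` rows are such that few rows are far from all of them. -/
theorem exists_net_of_sum_isolated_le {m p N : ℕ} (far : Fin m → Fin m → Prop)
    [DecidableRel far]
    (h : N * ∑ x : Fin (p + 1) → Fin m,
      (Finset.univ.filter fun k => ∀ j, j ≠ k → far (x k) (x j)).card ≤ (p + 1) * m ^ (p + 1))
    (hm : 0 < m) :
    ∃ x : Fin p → Fin m, N * (Finset.univ.filter fun r => ∀ j, far r (x j)).card ≤ m := by
  classical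
  by_contra hcon
  push Not at hcon
  have hk : ∀ k : Fin (p + 1), m ^ (p + 1) < N * (Finset.univ.filter fun x : Fin (p + 1) → Fin m =>
      ∀ j, j ≠ k → far (x k) (x j)).card := by
    intro k
    have h1 : (Finset.univ.filter fun x : Fin (p + 1) → Fin m =>
        ∀ j, j ≠ k → far (x k) (x j)).card =
        ∑ x : Fin p → Fin m, (Finset.univ.filter fun r => ∀ j, far r (x j)).card := by
      simp only [Finset.card_filter]
      -- The row at place `k` is independent of the other `p`, so it plays the role of a random row
      -- tested against a random net.
      rw [← (Fin.insertNthEquiv (fun _ => Fin m) k).sum_comp, Fintype.sum_prod_type_right]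
      refine Finset.sum_congr rfl fun x _ => Finset.sum_congr rfl fun r _ => ?_
      congr 1
      simp [Fin.forall_iff_succAbove k]
    rw [h1, Finset.mul_sum]
    have : Nonempty (Fin m) := ⟨⟨0, hm⟩⟩
    calc m ^ (p + 1) = ∑ _x : Fin p → Fin m, m := by simp [pow_succ]
      _ < _ := Finset.sum_lt_sum_of_nonempty Finset.univ_nonempty fun x _ => hcon x
  have h2 : ∑ x : Fin (p + 1) → Fin m,
      (Finset.univ.filter fun k => ∀ j, j ≠ k → far (x k) (x j)).card =
      ∑ k : Fin (p + 1), (Finset.univ.filter fun x : Fin (p + 1) → Fin m =>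
        ∀ j, j ≠ k → far (x k) (x j)).card := by
    simp only [Finset.card_filter]
    exact Finset.sum_comm
  rw [h2, Finset.mul_sum] at h
  refine absurd h (not_le.2 ?_)
  calc (p + 1) * m ^ (p + 1) = ∑ _k : Fin (p + 1), m ^ (p + 1) := by simp
    _ < _ := Finset.sum_lt_sum_of_nonempty Finset.univ_nonempty fun k _ => hk k

/-- Either `A` has many copies, or almost all rows are close to one of few rows. -/
theorem many_copies_or_exists_row_net {s t : ℕ} (A : Matrix (Fin s) (Fin t) (Fin 2)) :
    ∃ F : ℕ → ℕ, PolyBounded F ∧ ∀ N, 1 ≤ N → ∀ (n : ℕ) (M : Matrix (Fin n) (Fin n) (Fin 2)),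
      0 < n → n ^ (s + t) ≤ F N * (copies A M).ncard ∨
      ∃ X : Finset (Fin n), X.card ≤ F N ∧
        ∃ B : Finset (Fin n), N * B.card ≤ n ∧ ∀ r ∉ B, ∃ x ∈ X, ¬ FarRows N M r x := by
  classical
  set D := Fintype.card (Equiv.Perm (Fin s)) * t + s with hD
  obtain ⟨c, hc⟩ := exists_sample_size D
  let q : ℕ → ℕ := fun N => c * N ^ 2
  -- The factor `3 * N` makes the Sauer–Shelah bound `(q + 1) ^ D` a `1 / (3 * N)` fraction of the
  -- sampled rows.
  let P : ℕ → ℕ := fun N => 3 * N * (q N + 1) ^ D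
  have hq : PolyBounded q := (PolyBounded.const c).mul (PolyBounded.id.pow 2)
  have hP : PolyBounded P := ((PolyBounded.const 3).mul PolyBounded.id).mul
    ((hq.add (PolyBounded.const 1)).pow D)
  refine ⟨fun N => P N + 3 * N * (P N ^ s * q N ^ t),
    hP.add (((PolyBounded.const 3).mul PolyBounded.id).mul ((hP.pow s).mul (hq.pow t))),
    fun N hN n M hn => ?_⟩
  by_cases hcop : n ^ (s + t) ≤ (P N + 3 * N * (P N ^ s * q N ^ t)) * (copies A M).ncard
  · exact Or.inl hcop
  right
  push Not at hcop
  have hPpos : 0 < P N := by positivity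
  obtain ⟨p, hp⟩ : ∃ p, P N = p + 1 := ⟨P N - 1, by omega⟩
  let T : Finset ((Fin (P N) → Fin n) × (Fin (q N) → Fin n)) := Finset.univ.filter fun z =>
    ∃ S ∈ copies A M, Set.range S.1 ⊆ Set.range z.1 ∧ Set.range S.2 ⊆ Set.range z.2
  let Z : Finset ((Fin (P N) → Fin n) × (Fin (q N) → Fin n)) := Finset.univ.filter fun z =>
    ∃ k k', FarRows N M (z.1 k) (z.1 k') ∧ ∀ l, M (z.1 k) (z.2 l) = M (z.1 k') (z.2 l)
  have hT : 3 * N * T.card ≤ n ^ P N * n ^ q N := by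
    have h := card_sample_contains_copy_le A M T (fun z hz => by simpa [T] using hz)
    rw [← pow_add n s t] at h
    refine Nat.le_of_mul_le_mul_left ?_ (pow_pos hn (s + t))
    calc n ^ (s + t) * (3 * N * T.card) = 3 * N * (n ^ (s + t) * T.card) := by ring
      _ ≤ 3 * N * (P N ^ s * q N ^ t * (copies A M).ncard * (n ^ P N * n ^ q N)) := by gcongr
      _ = (3 * N * (P N ^ s * q N ^ t)) * (copies A M).ncard * (n ^ P N * n ^ q N) := by ring
      _ ≤ (P N + 3 * N * (P N ^ s * q N ^ t)) * (copies A M).ncard * (n ^ P N * n ^ q N) := by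
          gcongr; omega
      _ ≤ _ := by gcongr
  have hZ : 3 * N * Z.card ≤ n ^ P N * n ^ q N := by
    have h := card_not_separated_le (N := N) M Z (fun z hz => by simpa [Z] using hz)
    refine Nat.le_of_mul_le_mul_left ?_ (pow_pos hN (q N))
    calc N ^ q N * (3 * N * Z.card) = 3 * N * (N ^ q N * Z.card) := by ring
      _ ≤ 3 * N * (P N ^ 2 * (N - 1) ^ q N * (n ^ P N * n ^ q N)) := by gcongr
      _ = 3 * N * (P N ^ 2 * (N - 1) ^ q N) * (n ^ P N * n ^ q N) := by ring
      _ ≤ _ := by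
        gcongr
        exact hc N hN
  let iso : (Fin (P N) → Fin n) → Finset (Fin (P N)) := fun x =>
    Finset.univ.filter fun k => ∀ j, j ≠ k → FarRows N M (x k) (x j)
  have hiso : ∀ z : (Fin (P N) → Fin n) × (Fin (q N) → Fin n),
      (iso z.1).card ≤ (q N + 1) ^ D + P N * (if z ∈ T then 1 else 0) +
        P N * (if z ∈ Z then 1 else 0) := by
    intro z
    have hle : (iso z.1).card ≤ P N := (Finset.card_le_univ _).trans (by simp)
    by_cases hzT : z ∈ T
    · simp only [hzT, if_true]; omega
    by_cases hzZ : z ∈ Z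
    · simp only [hzZ, if_true]; omega
    simp only [T, Finset.mem_filter, Finset.mem_univ, true_and] at hzT
    simp only [Z, Finset.mem_filter, Finset.mem_univ, true_and] at hzZ
    push Not at hzZ
    -- Isolated rows are pairwise far, hence have distinct patterns in a sample that separates far
    -- rows.
    have := (exists_copy_or_card_le A M z.1 z.2 (iso z.1) (by
      intro k hk k' _ hkk
      by_contra hne
      simp only [iso, Finset.mem_filter, Finset.mem_univ, true_and] at hk
      obtain ⟨l, hl⟩ := hzZ k k' (hk k' (Ne.symm hne))
      exact hl (hkk l))).resolve_left hzT
    rw [← hD] at this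
    omega
  have hsum : n ^ q N * (N * ∑ x, (iso x).card) ≤ n ^ q N * (P N * n ^ P N) := by
    have h1 : ∑ z : (Fin (P N) → Fin n) × (Fin (q N) → Fin n), (iso z.1).card =
        n ^ q N * ∑ x, (iso x).card := by
      rw [Fintype.sum_prod_type]
      simp [Finset.mul_sum]
    have h2 : ∑ z : (Fin (P N) → Fin n) × (Fin (q N) → Fin n), (iso z.1).card ≤
        n ^ P N * n ^ q N * (q N + 1) ^ D + P N * T.card + P N * Z.card := by
      refine (Finset.sum_le_sum fun z _ => hiso z).trans (le_of_eq ?_)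
      rw [Finset.sum_add_distrib, Finset.sum_add_distrib, ← Finset.mul_sum, ← Finset.mul_sum]
      simp
    -- Three contributions of at most `1 / (3 * N)` each: the pattern bound, samples containing a
    -- copy, and samples that fail to separate.
    have h3 : 3 * (n ^ q N * (N * ∑ x, (iso x).card)) ≤ 3 * (n ^ q N * (P N * n ^ P N)) := by
      calc 3 * (n ^ q N * (N * ∑ x, (iso x).card)) = 3 * N * (n ^ q N * ∑ x, (iso x).card) := by
            ring
        _ ≤ 3 * N * (n ^ P N * n ^ q N * (q N + 1) ^ D + P N * T.card + P N * Z.card) := by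
            rw [← h1]; gcongr
        _ = n ^ P N * n ^ q N * P N + P N * (3 * N * T.card) + P N * (3 * N * Z.card) := by
            simp only [P]; ring
        _ ≤ n ^ P N * n ^ q N * P N + P N * (n ^ P N * n ^ q N) + P N * (n ^ P N * n ^ q N) := by
            gcongr
        _ = _ := by ring
    omega
  have hsum' := Nat.le_of_mul_le_mul_left hsum (pow_pos hn _)
  obtain ⟨x, hx⟩ : ∃ x : Fin p → Fin n,
      N * (Finset.univ.filter fun r => ∀ j, FarRows N M r (x j)).card ≤ n := by
    apply exists_net_of_sum_isolated_le (FarRows N M) _ hn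
    simp only [iso] at hsum'
    rw [hp] at hsum'
    exact hsum'
  refine ⟨Finset.univ.image x, ?_, _, hx, fun r hr => ?_⟩
  · refine Finset.card_image_le.trans ?_
    simp only [Finset.card_univ, Fintype.card_fin]
    omega
  · simpa using hr

theorem ncard_copies_transpose {Γ : Type*} {s t m n : ℕ} (A : Matrix (Fin s) (Fin t) Γ)
    (M : Matrix (Fin m) (Fin n) Γ) :
    (copies A.transpose M.transpose).ncard = (copies A M).ncard := by
  have h : copies A.transpose M.transpose = Prod.swap '' copies A M := by
    ext S
    simp only [Set.mem_image, Prod.exists, Prod.swap_prod_mk]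
    constructor
    · intro hS
      exact ⟨S.2, S.1, Matrix.transpose_injective hS, rfl⟩
    · rintro ⟨ρ, κ, h, rfl⟩
      exact congrArg Matrix.transpose h
  rw [h, Set.ncard_image_of_injective _ Prod.swap_injective]

/-- Either `A` has many copies, or replacing each row by one of few representatives changes few
entries. -/
theorem many_copies_or_exists_row_map {s t : ℕ} (A : Matrix (Fin s) (Fin t) (Fin 2)) :
    ∃ F : ℕ → ℕ, PolyBounded F ∧ ∀ N, 1 ≤ N → ∀ (n : ℕ) (M : Matrix (Fin n) (Fin n) (Fin 2)),
      0 < n → n ^ (s + t) ≤ F N * (copies A M).ncard ∨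
      ∃ i : Fin n → Fin n, (Finset.univ.image i).card ≤ F N ∧
        N * (Finset.univ.filter fun z : Fin n × Fin n => M z.1 z.2 ≠ M (i z.1) z.2).card ≤
          n ^ 2 := by
  classical
  obtain ⟨F, hF, h⟩ := many_copies_or_exists_row_net A
  -- Half of the error budget pays for the exceptional rows, half for the remaining ones. The `+ 1`
  -- is for row `0`, which represents all exceptional rows.
  refine ⟨fun N => F (2 * N) + 1,
    (hF.comp ((PolyBounded.const 2).mul PolyBounded.id)).add (PolyBounded.const 1),
    fun N hN n M hn => ?_⟩
  rcases h (2 * N) (by omega) n M hn with h | ⟨X, hX, B, hB, hBX⟩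
  · left
    exact h.trans (Nat.mul_le_mul_right _ (Nat.le_succ _))
  right
  let i : Fin n → Fin n := fun r => if h : r ∈ B then ⟨0, hn⟩ else (hBX r h).choose
  refine ⟨i, ?_, ?_⟩
  · have : Finset.univ.image i ⊆ insert ⟨0, hn⟩ X := by
      intro v hv
      obtain ⟨r, -, rfl⟩ := Finset.mem_image.1 hv
      by_cases hr : r ∈ B
      · simp [i, hr]
      · simp only [i, hr, dif_neg, not_false_eq_true]
        exact Finset.mem_insert_of_mem (hBX r hr).choose_spec.1
    exact (Finset.card_le_card this).trans ((Finset.card_insert_le _ _).trans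
      (Nat.succ_le_succ hX))
  · have h1 : (Finset.univ.filter fun z : Fin n × Fin n => M z.1 z.2 ≠ M (i z.1) z.2).card =
        ∑ r, (Finset.univ.filter fun c => M r c ≠ M (i r) c).card := by
      simp only [Finset.card_filter, Fintype.sum_prod_type]
    have h2 : ∀ r, 2 * N * (Finset.univ.filter fun c => M r c ≠ M (i r) c).card ≤
        n + 2 * N * n * (if r ∈ B then 1 else 0) := by
      intro r
      by_cases hr : r ∈ B
      · simp only [hr, if_true, mul_one]
        have : (Finset.univ.filter fun c => M r c ≠ M (i r) c).card ≤ n :=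
          (Finset.card_le_univ _).trans (by simp)
        exact (Nat.mul_le_mul_left _ this).trans (Nat.le_add_left _ _)
      · have := (hBX r hr).choose_spec.2
        have hi : i r = (hBX r hr).choose := dif_neg hr
        rw [hi, if_neg hr, mul_zero, add_zero]
        exact Nat.le_of_not_lt this
    have h3 : 2 * (N * ∑ r, (Finset.univ.filter fun c => M r c ≠ M (i r) c).card) ≤
        2 * n ^ 2 := by
      calc 2 * (N * ∑ r, (Finset.univ.filter fun c => M r c ≠ M (i r) c).card)
          = ∑ r, 2 * N * (Finset.univ.filter fun c => M r c ≠ M (i r) c).card := by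
            rw [← mul_assoc, Finset.mul_sum]
        _ ≤ ∑ r, (n + 2 * N * n * (if r ∈ B then 1 else 0)) := Finset.sum_le_sum fun r _ => h2 r
        _ = n * n + n * (2 * N * B.card) := by
            rw [Finset.sum_add_distrib, ← Finset.mul_sum]
            simp only [Finset.sum_const, Finset.card_univ, Fintype.card_fin, smul_eq_mul,
              Finset.sum_boole, Finset.filter_univ_mem, Nat.cast_id]
            ring
        _ ≤ n * n + n * n := by gcongr
        _ = _ := by ring
    rw [h1]
    omega

/-- If `v` is not the majority value of `u` on `S`, then `u` differs from `v` on at least half of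
`S`. -/
theorem card_ne_majority_le {n : ℕ} (u : Fin n → Fin 2) (S : Finset (Fin n)) (v : Fin 2) :
    (S.filter fun _ => v ≠ if S.card ≤ 2 * (S.filter fun c => u c = 1).card then 1 else 0).card ≤
      2 * (S.filter fun c => u c ≠ v).card := by
  classical
  have h := Finset.card_filter_add_card_filter_not (s := S) (fun c => u c = 1)
  have hv : v = 0 ∨ v = 1 := by omega
  have h0 : (S.filter fun c => ¬ u c = 1) = S.filter fun c => u c = 0 :=
    Finset.filter_congr fun c _ => by omega
  have h1 : (S.filter fun c => ¬ u c = 0) = S.filter fun c => u c = 1 :=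
    Finset.filter_congr fun c _ => by omega
  split_ifs with hS
  · rcases hv with rfl | rfl
    · simpa [h1] using hS
    · simp
  · rcases hv with rfl | rfl
    · simp
    · simp only [ne_eq, one_ne_zero, not_false_eq_true, Finset.filter_true]
      omega

/-- Either `A` has many copies, or `M` agrees up to few entries with a matrix of few distinct rows
and columns. -/
theorem many_copies_or_exists_block_approx {s t : ℕ} (A : Matrix (Fin s) (Fin t) (Fin 2)) :
    ∃ F : ℕ → ℕ, PolyBounded F ∧ ∀ N, 1 ≤ N → ∀ (n : ℕ) (M : Matrix (Fin n) (Fin n) (Fin 2)),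
      0 < n → n ^ (s + t) ≤ F N * (copies A M).ncard ∨
      ∃ (i j : Fin n → Fin n) (f : Fin n → Fin n → Fin 2),
        (Finset.univ.image i).card ≤ F N ∧ (Finset.univ.image j).card ≤ F N ∧
        N * (Finset.univ.filter fun z : Fin n × Fin n => M z.1 z.2 ≠ f (i z.1) (j z.2)).card ≤
          n ^ 2 := by
  classical
  obtain ⟨F, hF, h⟩ := many_copies_or_exists_row_map A
  obtain ⟨G, hG, h'⟩ := many_copies_or_exists_row_map A.transpose
  have h5 : PolyBounded fun N => 5 * N := (PolyBounded.const 5).mul PolyBounded.id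
  -- The total error will be at most `2 * E₁.card + 3 * E₂.card`, hence the factor `5`.
  refine ⟨fun N => F (5 * N) + G (5 * N), (hF.comp h5).add (hG.comp h5), fun N hN n M hn => ?_⟩
  rcases h (5 * N) (by omega) n M hn with h | ⟨i, hi, hiM⟩
  · left
    exact h.trans (Nat.mul_le_mul_right _ (Nat.le_add_right _ _))
  rcases h' (5 * N) (by omega) n M.transpose hn with h | ⟨j, hj, hjM⟩
  · left
    rw [ncard_copies_transpose, add_comm t s] at h
    exact h.trans (Nat.mul_le_mul_right _ (Nat.le_add_left _ _))
  right
  -- The value `M (i r) (j c)` would not do: column `j c` is close to column `c` only on average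
  -- over rows, and the row `i r` may be untypical. The majority of row `i r` over the class of `j
  -- c` is robust.
  let f : Fin n → Fin n → Fin 2 := fun r v =>
    if (Finset.univ.filter fun c => j c = v).card ≤
      2 * ((Finset.univ.filter fun c => j c = v).filter fun c => M r c = 1).card then 1 else 0
  refine ⟨i, j, f, hi.trans (Nat.le_add_right _ _), hj.trans (Nat.le_add_left _ _), ?_⟩
  set E₁ := Finset.univ.filter fun z : Fin n × Fin n => M z.1 z.2 ≠ M (i z.1) z.2 with hE₁
  set E₂ := Finset.univ.filter fun z : Fin n × Fin n => M z.1 z.2 ≠ M z.1 (j z.2) with hE₂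
  have hE₂card : (Finset.univ.filter fun z : Fin n × Fin n =>
      M.transpose z.1 z.2 ≠ M.transpose (j z.1) z.2).card = E₂.card := by
    refine Finset.card_equiv (Equiv.prodComm _ _) fun z => ?_
    rw [hE₂, Finset.mem_filter, Finset.mem_filter]
    simp
  rw [hE₂card] at hjM
  set W := Finset.univ.filter fun z : Fin n × Fin n => M (i z.1) z.2 ≠ M z.1 (j z.2) with hW
  have hWcard : W.card ≤ E₁.card + E₂.card := by
    refine (Finset.card_le_card ?_).trans (Finset.card_union_le _ _)
    intro z
    simp only [hW, hE₁, hE₂, Finset.mem_filter, Finset.mem_univ, true_and, Finset.mem_union]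
    intro hz
    by_contra hcon
    push Not at hcon
    exact hz (hcon.1.symm.trans hcon.2)
  set V := Finset.univ.filter fun z : Fin n × Fin n => M z.1 (j z.2) ≠ f (i z.1) (j z.2) with hV
  have hVcard : V.card ≤ 2 * W.card := by
    simp only [hV, hW, Finset.card_filter, Fintype.sum_prod_type]
    rw [Finset.mul_sum]
    refine Finset.sum_le_sum fun r _ => ?_
    rw [← Finset.card_filter, ← Finset.card_filter,
      Finset.card_eq_sum_card_fiberwise (f := j) (t := Finset.univ) (by simp),
      Finset.card_eq_sum_card_fiberwise (f := j) (t := Finset.univ) (by simp), Finset.mul_sum]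
    refine Finset.sum_le_sum fun v _ => ?_
    have := card_ne_majority_le (M (i r)) (Finset.univ.filter fun c => j c = v) (M r v)
    refine le_trans (Finset.card_le_card fun c => ?_) (this.trans
      (Nat.mul_le_mul_left _ (Finset.card_le_card fun c => ?_)))
    · simp only [Finset.mem_filter, Finset.mem_univ, true_and]
      rintro ⟨h1, rfl⟩
      exact ⟨rfl, h1⟩
    · simp only [Finset.mem_filter, Finset.mem_univ, true_and]
      rintro ⟨rfl, h1⟩
      exact ⟨h1, rfl⟩
  have hU : (Finset.univ.filter fun z : Fin n × Fin n =>
      M z.1 z.2 ≠ f (i z.1) (j z.2)).card ≤ E₂.card + V.card := by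
    refine (Finset.card_le_card ?_).trans (Finset.card_union_le _ _)
    intro z
    simp only [hV, hE₂, Finset.mem_filter, Finset.mem_univ, true_and, Finset.mem_union]
    intro hz
    by_contra hcon
    push Not at hcon
    exact hz (hcon.1.trans hcon.2)
  have hfin : (Finset.univ.filter fun z : Fin n × Fin n =>
      M z.1 z.2 ≠ f (i z.1) (j z.2)).card ≤ 2 * E₁.card + 3 * E₂.card := by omega
  have := Nat.mul_le_mul_left N hfin
  nlinarith

/-! ### Initial segments and order-preserving refinements -/

theorem Finset.exists_initial_segment {α : Type*} [LinearOrder α] (S : Finset α) (k : ℕ)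
    (hk : k ≤ S.card) :
    ∃ B ⊆ S, B.card = k ∧ ∀ b ∈ B, ∀ d ∈ S, d ∉ B → b < d := by
  induction k with
  | zero => exact ⟨∅, by simp, rfl, by simp⟩
  | succ k ih =>
    obtain ⟨B, hBS, hB, hlt⟩ := ih (by omega)
    have hne : (S \ B).Nonempty := by
      rw [← Finset.card_pos, Finset.card_sdiff_of_subset hBS]
      omega
    have hmem := Finset.mem_sdiff.1 ((S \ B).min'_mem hne)
    refine ⟨insert ((S \ B).min' hne) B, Finset.insert_subset hmem.1 hBS, ?_, ?_⟩
    · rw [Finset.card_insert_of_notMem hmem.2, hB]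
    · intro b hb d hd hdB
      rw [Finset.mem_insert, not_or] at hdB
      rcases Finset.mem_insert.1 hb with rfl | hb
      · exact lt_of_le_of_ne (Finset.min'_le _ _ (Finset.mem_sdiff.2 ⟨hd, hdB.2⟩))
          (Ne.symm hdB.1)
      · exact hlt b hb d hd hdB.2

/-- Initial segments `B v` of proportion `1 / H` of the colour classes, and a monotone function `w`
with few values that separates the initial segment of a class from the rest of that class. -/
theorem exists_initial_segments {n : ℕ} {κ : Type*} [DecidableEq κ] (g : Fin n → κ) (H : ℕ)
    (hH : 1 ≤ H) :
    ∃ (B : κ → Finset (Fin n)) (w : Fin n → ℕ),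
      (∀ v, ∀ b ∈ B v, g b = v) ∧
      (∀ v, (Finset.univ.filter fun r => g r = v).card ≤ H * (B v).card) ∧
      H * (Finset.univ.filter fun r => r ∈ B (g r)).card ≤
        n + H * (Finset.univ.image g).card ∧
      Monotone w ∧ (∀ r b, r ∉ B (g r) → b ∈ B (g r) → w b < w r) ∧
      ∀ r, w r ≤ (Finset.univ.image g).card := by
  classical
  let D : κ → Finset (Fin n) := fun v => Finset.univ.filter fun r => g r = v
  -- Segment sizes are rounded up, so that every nonempty class has a nonempty segment; this costs
  -- at most `H` per class.
  have hk : ∀ v, ((D v).card + H - 1) / H ≤ (D v).card := by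
    intro v
    rw [Nat.div_le_iff_le_mul_add_pred (by omega)]
    have : (D v).card ≤ H * (D v).card := Nat.le_mul_of_pos_left _ hH
    omega
  choose B hBD hB hlt using fun v => (D v).exists_initial_segment _ (hk v)
  have hBg : ∀ v, ∀ b ∈ B v, g b = v := fun v b hb => by simpa [D] using hBD v hb
  have hup : ∀ v, H * (B v).card ≤ (D v).card + H := fun v => by
    rw [hB]
    exact (Nat.mul_div_le _ _).trans (by omega)
  -- `w r` counts the classes whose initial segment ends before `r`. The class of `r ∉ B (g r)` is
  -- counted at `r`, but not at a member of its own segment.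
  refine ⟨B, fun r => ((Finset.univ.image g).filter fun v => ∀ b ∈ B v, b < r).card,
    hBg, fun v => ?_, ?_, ?_, ?_, fun r => Finset.card_filter_le _ _⟩
  · rw [hB]
    have := Nat.lt_mul_div_succ ((D v).card + H - 1) hH
    change (D v).card ≤ _
    rw [Nat.mul_add] at this
    omega
  · have h1 : (Finset.univ.filter fun r => r ∈ B (g r)).card ≤
        ∑ v ∈ Finset.univ.image g, (B v).card := by
      refine (Finset.card_le_card ?_).trans Finset.card_biUnion_le
      intro r hr
      simp only [Finset.mem_filter, Finset.mem_univ, true_and] at hr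
      exact Finset.mem_biUnion.2 ⟨g r, Finset.mem_image_of_mem _ (Finset.mem_univ _), hr⟩
    have h2 : ∑ v ∈ Finset.univ.image g, (D v).card = n := by
      rw [← Finset.card_eq_sum_card_fiberwise (s := Finset.univ) (f := g)
        (fun r _ => Finset.mem_coe.2 (Finset.mem_image_of_mem _ (Finset.mem_univ r)))]
      simp
    calc _ ≤ H * ∑ v ∈ Finset.univ.image g, (B v).card := by gcongr
      _ = ∑ v ∈ Finset.univ.image g, H * (B v).card := by rw [Finset.mul_sum]
      _ ≤ ∑ v ∈ Finset.univ.image g, ((D v).card + H) := Finset.sum_le_sum fun v _ => hup v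
      _ = _ := by
        rw [Finset.sum_add_distrib, h2, Finset.sum_const, smul_eq_mul, Nat.mul_comm]
  · intro r r' hrr
    refine Finset.card_le_card fun v => ?_
    simp only [Finset.mem_filter]
    exact fun h => ⟨h.1, fun b hb => (h.2 b hb).trans_le hrr⟩
  · intro r b hr hb
    have hbr : ∀ b' ∈ B (g r), b' < r := fun b' hb' =>
      hlt (g r) b' hb' r (by simp [D]) hr
    refine Finset.card_lt_card ⟨fun v => ?_, fun hcon => ?_⟩
    · simp only [Finset.mem_filter]
      exact fun h => ⟨h.1, fun b' hb' => (h.2 b' hb').trans (hbr b hb)⟩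
    · have := hcon (Finset.mem_filter.2 ⟨Finset.mem_image_of_mem _ (Finset.mem_univ r), hbr⟩)
      exact lt_irrefl b ((Finset.mem_filter.1 this).2 b hb)

/-- Successive refinements `g a` of a colouring `i` such that rows `r < r'` can be replaced by
rows from the initial segments of their classes for `g a` and `g (a + 1)` without changing the
order, unless `r` itself lies in an initial segment. -/
theorem exists_ordered_refinements {n : ℕ} {κ : Type*} [DecidableEq κ] (i : Fin n → κ) (H m : ℕ)
    (hH : 1 ≤ H) (hm : (Finset.univ.image i).card ≤ m) :
    ∃ (g : ℕ → Fin n → κ × ℕ) (B : ℕ → κ × ℕ → Finset (Fin n)),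
      (∀ a r, (g a r).1 = i r) ∧
      (∀ a, (Finset.univ.image (g a)).card ≤ (m + 1) ^ (a + 1)) ∧
      (∀ a v, ∀ b ∈ B a v, g a b = v) ∧
      (∀ a v, (Finset.univ.filter fun r => g a r = v).card ≤ H * (B a v).card) ∧
      (∀ a, H * (Finset.univ.filter fun r => r ∈ B a (g a r)).card ≤
        n + H * (Finset.univ.image (g a)).card) ∧
      ∀ a r r' b b', r < r' → r ∉ B a (g a r) → b ∈ B a (g a r) →
        b' ∈ B (a + 1) (g (a + 1) r') → b < b' := by
  classical
  choose B w hB1 hB2 hB3 hw1 hw2 hw3 using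
    fun g : Fin n → κ × ℕ => exists_initial_segments g H hH
  let W : ℕ → Fin n → ℕ := fun a => Nat.rec (fun _ => 0) (fun _ w' => w fun r => (i r, w' r)) a
  let g : ℕ → Fin n → κ × ℕ := fun a r => (i r, W a r)
  have hWsucc : ∀ a, W (a + 1) = w (g a) := fun a => rfl
  -- The `+ 1` carries the induction: a counter bounded by the number of classes has one more
  -- possible value.
  have hcard : ∀ a, (Finset.univ.image (g a)).card + 1 ≤ (m + 1) ^ (a + 1) := by
    intro a
    induction a with
    | zero =>
      have : Finset.univ.image (g 0) ⊆ (Finset.univ.image i).image fun x => (x, 0) := by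
        intro v hv
        obtain ⟨r, -, rfl⟩ := Finset.mem_image.1 hv
        exact Finset.mem_image_of_mem _ (Finset.mem_image_of_mem _ (Finset.mem_univ r))
      have := (Finset.card_le_card this).trans Finset.card_image_le
      rw [zero_add, pow_one]
      omega
    | succ a ih =>
      have : Finset.univ.image (g (a + 1)) ⊆
          Finset.univ.image i ×ˢ Finset.range ((Finset.univ.image (g a)).card + 1) := by
        intro v hv
        obtain ⟨r, -, rfl⟩ := Finset.mem_image.1 hv
        refine Finset.mem_product.2 ⟨Finset.mem_image_of_mem _ (Finset.mem_univ r), ?_⟩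
        rw [Finset.mem_range, Nat.lt_succ_iff]
        exact hw3 (g a) r
      have := Finset.card_le_card this
      rw [Finset.card_product, Finset.card_range] at this
      have h1 : 1 ≤ (m + 1) ^ (a + 1) := Nat.one_le_pow _ _ (by omega)
      calc (Finset.univ.image (g (a + 1))).card + 1
          ≤ m * (m + 1) ^ (a + 1) + (m + 1) ^ (a + 1) :=
            add_le_add (this.trans (Nat.mul_le_mul hm ih)) h1
        _ = _ := by ring
  refine ⟨g, fun a => B (g a), fun _ _ => rfl, fun a => (Nat.le_succ _).trans (hcard a),
    fun a => hB1 (g a), fun a => hB2 (g a), fun a => hB3 (g a), ?_⟩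
  intro a r r' b b' hrr hr hb hb'
  -- `w b < w r ≤ w r' = w b'`, the equality because the next colouring records `w`. Monotonicity of
  -- `w` then gives `b < b'`.
  have h1 : w (g a) b < w (g a) r := hw2 (g a) r b hr hb
  have h2 : w (g a) r ≤ w (g a) r' := hw1 (g a) hrr.le
  have h3 : w (g a) b' = w (g a) r' := congrArg Prod.snd (hB1 (g (a + 1)) _ b' hb')
  by_contra hcon
  have := hw1 (g a) (not_lt.1 hcon)
  omega

/-! ### From one clean copy to many -/

/-- If consecutive sets of rows, and consecutive sets of columns, are ordered, and all blocks
mostly agree with `A`, then at least half of the choices of rows and columns are copies of `A`. -/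
theorem prod_card_le_two_mul_ncard_copies {s t n : ℕ} (A : Matrix (Fin s) (Fin t) (Fin 2))
    (M : Matrix (Fin n) (Fin n) (Fin 2)) (B : Fin s → Finset (Fin n)) (C : Fin t → Finset (Fin n))
    (hB : ∀ ρ : Fin s → Fin n, (∀ a, ρ a ∈ B a) → StrictMono ρ)
    (hC : ∀ κ : Fin t → Fin n, (∀ b, κ b ∈ C b) → StrictMono κ)
    (h : ∀ a b, 2 * (s * t) * ((B a ×ˢ C b).filter fun z => M z.1 z.2 ≠ A a b).card ≤
      (B a).card * (C b).card) :
    (∏ a, (B a).card) * ∏ b, (C b).card ≤ 2 * (copies A M).ncard := by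
  classical
  let Ω := Fintype.piFinset B ×ˢ Fintype.piFinset C
  let W : Fin s × Fin t → Finset ((Fin s → Fin n) × (Fin t → Fin n)) := fun x =>
    Ω.filter fun z => M (z.1 x.1) (z.2 x.2) ≠ A x.1 x.2
  have hΩ : Ω.card = (∏ a, (B a).card) * ∏ b, (C b).card := by
    simp [Ω, Finset.card_product, Fintype.card_piFinset]
  have hW : ∀ x, 2 * (s * t) * (W x).card ≤ Ω.card := by
    rintro ⟨a, b⟩
    set X := (B a ×ˢ C b).filter fun z => M z.1 z.2 ≠ A a b with hX
    have h1 : (W (a, b)).card = X.card * ((∏ a' ∈ Finset.univ.erase a, (B a').card) *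
        ∏ b' ∈ Finset.univ.erase b, (C b').card) := by
      rw [Finset.card_eq_sum_card_fiberwise (s := W (a, b)) (f := fun z => (z.1 a, z.2 b))
        (t := X)]
      · rw [Finset.sum_const_nat]
        rintro ⟨r, c⟩ hrc
        simp only [hX, Finset.mem_filter, Finset.mem_product] at hrc
        have : ((W (a, b)).filter fun z => (z.1 a, z.2 b) = (r, c)) =
            ((Fintype.piFinset B).filter fun ρ => ρ a = r) ×ˢ
            ((Fintype.piFinset C).filter fun κ => κ b = c) := by
          ext z
          simp only [W, Ω, Finset.mem_filter, Finset.mem_product, Prod.mk.injEq]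
          constructor
          · rintro ⟨⟨⟨h1, h2⟩, -⟩, h3, h4⟩
            exact ⟨⟨h1, h3⟩, h2, h4⟩
          · rintro ⟨⟨h1, h3⟩, h2, h4⟩
            exact ⟨⟨⟨h1, h2⟩, by rw [h3, h4]; exact hrc.2⟩, h3, h4⟩
        rw [this, Finset.card_product, Fintype.card_filter_piFinset_eq_of_mem _ _ hrc.1.1,
          Fintype.card_filter_piFinset_eq_of_mem _ _ hrc.1.2]
      · intro z hz
        simp only [W, Ω, Finset.coe_filter, Finset.mem_product, Fintype.mem_piFinset,
          Set.mem_ofPred_eq] at hz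
        simp only [hX, Finset.coe_filter, Finset.mem_product, Set.mem_ofPred_eq]
        exact ⟨⟨hz.1.1 a, hz.1.2 b⟩, hz.2⟩
    rw [h1, hΩ, ← Finset.mul_prod_erase _ _ (Finset.mem_univ a),
      ← Finset.mul_prod_erase _ _ (Finset.mem_univ b)]
    calc _ = 2 * (s * t) * X.card * ((∏ a' ∈ Finset.univ.erase a, (B a').card) *
        ∏ b' ∈ Finset.univ.erase b, (C b').card) := by ring
      _ ≤ (B a).card * (C b).card * ((∏ a' ∈ Finset.univ.erase a, (B a').card) *
        ∏ b' ∈ Finset.univ.erase b, (C b').card) := Nat.mul_le_mul_right _ (h a b)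
      _ = _ := by ring
  -- Union bound over the `s * t` entries of `A`, each wrong with probability at most `1 / (2 * s *
  -- t)`.
  have hbad : 2 * ((Finset.univ : Finset (Fin s × Fin t)).biUnion W).card ≤ Ω.card := by
    rcases Nat.eq_zero_or_pos (s * t) with h0 | hpos
    · have : IsEmpty (Fin s × Fin t) := by
        rw [← Fintype.card_eq_zero_iff]
        simpa using h0
      simp [Finset.univ_eq_empty]
    · refine Nat.le_of_mul_le_mul_left ?_ hpos
      calc s * t * (2 * ((Finset.univ : Finset (Fin s × Fin t)).biUnion W).card)
          ≤ s * t * (2 * ∑ x, (W x).card) := by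
            gcongr
            exact Finset.card_biUnion_le
        _ = ∑ x, 2 * (s * t) * (W x).card := by rw [← Finset.mul_sum]; ring
        _ ≤ ∑ _x : Fin s × Fin t, Ω.card := Finset.sum_le_sum fun x _ => hW x
        _ = _ := by simp
  have hgood : (Ω \ (Finset.univ : Finset (Fin s × Fin t)).biUnion W).card ≤
      (copies A M).ncard := by
    rw [Set.ncard_eq_toFinset_card _ (copies_finite A M)]
    have hmem : ∀ z ∈ Ω, StrictMono z.1 ∧ StrictMono z.2 := fun z hz => by
      simp only [Ω, Finset.mem_product, Fintype.mem_piFinset] at hz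
      exact ⟨hB _ hz.1, hC _ hz.2⟩
    refine (Finset.card_le_card ?_).trans (Finset.card_image_le
      (s := (copies_finite A M).toFinset) (f := fun S => ((S.1 : Fin s → Fin n),
        (S.2 : Fin t → Fin n))))
    intro z hz
    rw [Finset.mem_sdiff] at hz
    refine Finset.mem_image.2 ⟨(OrderEmbedding.ofStrictMono _ (hmem z hz.1).1,
      OrderEmbedding.ofStrictMono _ (hmem z hz.1).2), ?_, rfl⟩
    rw [Set.Finite.mem_toFinset]
    show M.submatrix _ _ = A
    funext a b
    by_contra hne
    exact hz.2 (Finset.mem_biUnion.2 ⟨(a, b), Finset.mem_univ _,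
      Finset.mem_filter.2 ⟨hz.1, hne⟩⟩)
  have := Finset.le_card_sdiff ((Finset.univ : Finset (Fin s × Fin t)).biUnion W) Ω
  omega

/-- Each small class has fewer than `n / θ` elements, and there are at most as many of them as
classes. -/
theorem card_filter_small_class_le {α κ : Type*} [Fintype α] [DecidableEq κ] (g : α → κ)
    (θ n : ℕ) :
    θ * (Finset.univ.filter fun r => θ * (Finset.univ.filter fun r' => g r' = g r).card < n).card ≤
      (Finset.univ.image g).card * n := by
  classical
  rw [Finset.card_eq_sum_card_fiberwise (f := g) (t := Finset.univ.image g) (fun r _ =>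
    Finset.mem_coe.2 (Finset.mem_image_of_mem _ (Finset.mem_univ r))), Finset.mul_sum]
  refine (Finset.sum_le_card_nsmul _ _ n fun v _ => ?_).trans (le_of_eq (smul_eq_mul _ _))
  rcases Finset.eq_empty_or_nonempty ((Finset.univ.filter fun r =>
    θ * (Finset.univ.filter fun r' => g r' = g r).card < n).filter fun r => g r = v) with h | ⟨r, hr⟩
  · simp [h]
  · simp only [Finset.mem_filter, Finset.mem_univ, true_and] at hr
    obtain ⟨hr, rfl⟩ := hr
    refine (Nat.mul_le_mul_left _ (Finset.card_le_card ?_)).trans hr.le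
    exact Finset.filter_subset_filter _ (Finset.subset_univ _)

/-- The classes of `φ` in which the proportion of elements of `E` exceeds `1 / Γ` cover few
elements. -/
theorem card_filter_dense_class_le {α κ : Type*} [Fintype α] [DecidableEq κ] (φ : α → κ)
    (E : Finset α) (Γ : ℕ) :
    (Finset.univ.filter fun z => (Finset.univ.filter fun z' => φ z' = φ z).card <
      Γ * (E.filter fun z' => φ z' = φ z).card).card ≤ Γ * E.card := by
  classical
  rw [Finset.card_eq_sum_card_fiberwise (f := φ) (t := Finset.univ.image φ) (fun r _ =>
    Finset.mem_coe.2 (Finset.mem_image_of_mem _ (Finset.mem_univ r))),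
    Finset.card_eq_sum_card_fiberwise (s := E) (f := φ) (t := Finset.univ.image φ) (fun r _ =>
    Finset.mem_coe.2 (Finset.mem_image_of_mem _ (Finset.mem_univ r))), Finset.mul_sum]
  refine Finset.sum_le_sum fun v _ => ?_
  rcases Finset.eq_empty_or_nonempty ((Finset.univ.filter fun z =>
    (Finset.univ.filter fun z' => φ z' = φ z).card <
      Γ * (E.filter fun z' => φ z' = φ z).card).filter fun z => φ z = v) with h | ⟨z, hz⟩
  · simp [h]
  · simp only [Finset.mem_filter, Finset.mem_univ, true_and] at hz
    obtain ⟨hz, rfl⟩ := hz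
    refine (Finset.card_le_card ?_).trans hz.le
    exact Finset.filter_subset_filter _ (Finset.subset_univ _)

/-- Refinements as in `exists_ordered_refinements`, with a small exceptional set `R` outside of which
all the classes and their initial segments are large. -/
theorem exists_ordered_large_refinements {n : ℕ} {κ : Type*} [DecidableEq κ] (i : Fin n → κ)
    {Q m s K : ℕ} (hQ : 1 ≤ Q) (hm : (Finset.univ.image i).card ≤ m) (hK : (m + 1) ^ (s + 1) ≤ K)
    (hn : K * Q ≤ n) :
    ∃ (g : ℕ → Fin n → κ × ℕ) (B : ℕ → κ × ℕ → Finset (Fin n)) (R : Finset (Fin n)),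
      Q * R.card ≤ 3 * s * n ∧
      (∀ a r, (g a r).1 = i r) ∧
      (∀ a v, ∀ b ∈ B a v, g a b = v) ∧
      (∀ a v, (Finset.univ.filter fun r => g a r = v).card ≤ Q * (B a v).card) ∧
      (∀ a < s, ∀ r ∉ R, n ≤ K * Q * Q * (B a (g a r)).card) ∧
      ∀ a < s, ∀ r r' b b', r < r' → r ∉ R → b ∈ B a (g a r) →
        b' ∈ B (a + 1) (g (a + 1) r') → b < b' := by
  classical
  obtain ⟨g, B, hgi, hgK, hBg, hBQ, hBcard, hord⟩ := exists_ordered_refinements i Q m hQ hm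
  have hKpos : 0 < K := lt_of_lt_of_le (by positivity) hK
  have hgK' : ∀ a < s, (Finset.univ.image (g a)).card ≤ K := fun a ha =>
    (hgK a).trans ((Nat.pow_le_pow_right (by omega) (by omega)).trans hK)
  -- `X a` holds the rows inside initial segments, which block the exchange; `Y a` holds the rows in
  -- classes of size below `n / (K * Q)`.
  let X : ℕ → Finset (Fin n) := fun a => Finset.univ.filter fun r => r ∈ B a (g a r)
  let Y : ℕ → Finset (Fin n) := fun a => Finset.univ.filter fun r =>
    K * Q * (Finset.univ.filter fun r' => g a r' = g a r).card < n
  have hX : ∀ a < s, Q * (X a).card ≤ 2 * n := by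
    intro a ha
    have h1 : Q * (Finset.univ.image (g a)).card ≤ n :=
      (Nat.mul_le_mul_left Q (hgK' a ha)).trans ((Nat.mul_comm Q K).le.trans hn)
    exact (hBcard a).trans (by omega)
  have hY : ∀ a < s, Q * (Y a).card ≤ n := by
    intro a ha
    refine Nat.le_of_mul_le_mul_left ?_ hKpos
    rw [← mul_assoc]
    exact (card_filter_small_class_le (g a) (K * Q) n).trans (Nat.mul_le_mul_right _ (hgK' a ha))
  refine ⟨g, B, (Finset.range s).biUnion fun a => X a ∪ Y a, ?_, hgi, hBg, hBQ, ?_, ?_⟩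
  · calc Q * ((Finset.range s).biUnion fun a => X a ∪ Y a).card
        ≤ Q * ∑ a ∈ Finset.range s, ((X a).card + (Y a).card) := by
          gcongr
          exact Finset.card_biUnion_le.trans
            (Finset.sum_le_sum fun a _ => Finset.card_union_le _ _)
      _ = ∑ a ∈ Finset.range s, (Q * (X a).card + Q * (Y a).card) := by
          rw [Finset.mul_sum]
          simp only [Nat.mul_add]
      _ ≤ ∑ _a ∈ Finset.range s, 3 * n := by
          refine Finset.sum_le_sum fun a ha => ?_
          have h1 := hX a (Finset.mem_range.1 ha)
          have h2 := hY a (Finset.mem_range.1 ha)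
          omega
      _ = _ := by
          rw [Finset.sum_const, Finset.card_range, smul_eq_mul]
          ring
  · intro a ha r hr
    have h1 : r ∉ Y a := fun h =>
      hr (Finset.mem_biUnion.2 ⟨a, Finset.mem_range.2 ha, Finset.mem_union_right _ h⟩)
    simp only [Y, Finset.mem_filter, Finset.mem_univ, true_and, not_lt] at h1
    calc n ≤ _ := h1
      _ ≤ K * Q * (Q * (B a (g a r)).card) := by
          gcongr
          exact hBQ a _
      _ = _ := by ring
  · intro a ha r r' b b' hrr hr
    refine hord a r r' b b' hrr fun h => hr ?_
    exact Finset.mem_biUnion.2 ⟨a, Finset.mem_range.2 ha,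
      Finset.mem_union_left _ (Finset.mem_filter.2 ⟨Finset.mem_univ _, h⟩)⟩

theorem Fin.strictMono_of_lt_next {α : Type*} [Preorder α] {s : ℕ} (f : Fin s → α)
    (h : ∀ a (ha : a + 1 < s), f ⟨a, by omega⟩ < f ⟨a + 1, ha⟩) : StrictMono f := by
  cases s with
  | zero => exact fun a => a.elim0
  | succ s => exact Fin.strictMono_iff_lt_succ.2 fun a => h a.1 (by omega)

/-- Among more pairwise disjoint submatrices than there are bad entries, one avoids the bad
entries. -/
theorem exists_mem_entries_avoid {s t m n : ℕ} (U : Finset (SubmatrixPos s t m n))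
    (hU : (U : Set (SubmatrixPos s t m n)).PairwiseDisjoint SubmatrixPos.entries)
    (Bad : Finset (Fin m × Fin n)) (h : Bad.card < U.card) :
    ∃ S ∈ U, ∀ a b, (S.1 a, S.2 b) ∉ Bad := by
  classical
  by_contra hcon
  push Not at hcon
  obtain ⟨S₀, hS₀⟩ := Finset.card_pos.1 (Nat.zero_lt_of_lt h)
  obtain ⟨a₀, b₀, -⟩ := hcon S₀ hS₀
  have : Nonempty (Fin s) := ⟨a₀⟩
  have : Nonempty (Fin t) := ⟨b₀⟩
  -- One bad entry from each submatrix; disjointness makes the choice injective.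
  choose! a b hab using hcon
  refine absurd (Finset.card_le_card_of_injOn (fun S => (S.1 (a S), S.2 (b S)))
    (fun S hS => hab S hS) ?_) (not_le.2 h)
  intro S hS S' hS' heq
  by_contra hne
  have h1 : (S.1 (a S), S.2 (b S)) ∈ S.entries := ⟨⟨_, rfl⟩, ⟨_, rfl⟩⟩
  have h2 : (S.1 (a S), S.2 (b S)) ∈ S'.entries := by
    simp only at heq
    rw [heq]
    exact ⟨⟨_, rfl⟩, ⟨_, rfl⟩⟩
  exact Set.disjoint_left.1 (hU hS hS' hne) h1 h2

/-- Many copies from many disjoint copies, for a matrix close to one of few distinct rows and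
columns. -/
theorem many_copies_of_block_approx {s t n : ℕ} (hs : 0 < s) (ht : 0 < t)
    (A : Matrix (Fin s) (Fin t) (Fin 2)) (M : Matrix (Fin n) (Fin n) (Fin 2))
    {N Q m K : ℕ} (hN : 1 ≤ N) (hQ : N * (3 * s + 3 * t + s * t + 2) = Q)
    (hK : (m + 1) ^ (s + t + 1) = K) (hn : K * Q ≤ n)
    (U : Finset (SubmatrixPos s t n n)) (hUA : (U : Set (SubmatrixPos s t n n)) ⊆ copies A M)
    (hU : (U : Set (SubmatrixPos s t n n)).PairwiseDisjoint SubmatrixPos.entries)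
    (hUcard : n ^ 2 ≤ N * U.card) (i j : Fin n → Fin n) (f : Fin n → Fin n → Fin 2)
    (hi : (Finset.univ.image i).card ≤ m) (hj : (Finset.univ.image j).card ≤ m)
    (hf : 2 * (s * t) * Q ^ 2 * Q *
      (Finset.univ.filter fun z : Fin n × Fin n => M z.1 z.2 ≠ f (i z.1) (j z.2)).card ≤ n ^ 2) :
    n ^ (s + t) ≤ 2 * (K * Q * Q) ^ (s + t) * (copies A M).ncard := by
  classical
  have hQ1 : 1 ≤ Q := by rw [← hQ]; exact Nat.mul_pos hN (by omega)
  have hK1 : 1 ≤ K := by rw [← hK]; exact Nat.one_le_pow _ _ (by omega)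
  have hn0 : 0 < n := lt_of_lt_of_le (Nat.mul_pos hK1 hQ1) hn
  have hst : 1 ≤ s * t := Nat.mul_pos hs ht
  set Err := Finset.univ.filter fun z : Fin n × Fin n => M z.1 z.2 ≠ f (i z.1) (j z.2) with hErr
  obtain ⟨g, B, R, hR, hgi, hBg, hBQ, hBn, hBord⟩ :=
    exists_ordered_large_refinements (s := s) i hQ1 hi
      (by rw [← hK]; exact Nat.pow_le_pow_right (by omega) (by omega)) hn
  obtain ⟨g', C, R', hR', hgj, hCg, hCQ, hCn, hCord⟩ :=
    exists_ordered_large_refinements (s := t) j hQ1 hj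
      (by rw [← hK]; exact Nat.pow_le_pow_right (by omega) (by omega)) hn
  let φ : Fin s × Fin t → Fin n × Fin n → (Fin n × ℕ) × (Fin n × ℕ) :=
    fun x z => (g x.1 z.1, g' x.2 z.2)
  let Blk : Fin s × Fin t → Finset (Fin n × Fin n) := fun x => Finset.univ.filter fun z =>
    (Finset.univ.filter fun z' => φ x z' = φ x z).card <
      2 * (s * t) * Q ^ 2 * (Err.filter fun z' => φ x z' = φ x z).card
  have hBlk : ∀ x, Q * (Blk x).card ≤ n ^ 2 := fun x => by
    refine le_trans ?_ hf
    rw [Nat.mul_comm _ Q, mul_assoc]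
    exact Nat.mul_le_mul_left _ (card_filter_dense_class_le (φ x) Err _)
  -- In units of `n ^ 2 / Q` the parts cost `1`, `3 * s`, `3 * t` and `s * t`. The constant in `Q`
  -- is one larger than the sum, which gives the strict inequality with `U.card`.
  let Bad : Finset (Fin n × Fin n) :=
    Err ∪ (R ×ˢ Finset.univ ∪ (Finset.univ ×ˢ R' ∪ Finset.univ.biUnion Blk))
  have hErrQ : Q * Err.card ≤ n ^ 2 := by
    refine le_trans ?_ hf
    refine Nat.mul_le_mul_right _ (Nat.le_mul_of_pos_left _ ?_)
    positivity
  have hBad : Q * Bad.card ≤ (3 * s + 3 * t + s * t + 1) * n ^ 2 := by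
    have h1 : Bad.card ≤ Err.card + (R.card * n + (n * R'.card + ∑ x, (Blk x).card)) := by
      refine (Finset.card_union_le _ _).trans (Nat.add_le_add_left ?_ _)
      refine (Finset.card_union_le _ _).trans (Nat.add_le_add (by simp) ?_)
      exact (Finset.card_union_le _ _).trans (Nat.add_le_add (by simp) Finset.card_biUnion_le)
    have h2 : Q * ∑ x, (Blk x).card ≤ s * t * n ^ 2 := by
      rw [Finset.mul_sum]
      refine (Finset.sum_le_card_nsmul _ _ _ fun x _ => hBlk x).trans (le_of_eq ?_)
      simp
    calc Q * Bad.card ≤ Q * (Err.card + (R.card * n + (n * R'.card + ∑ x, (Blk x).card))) := by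
          gcongr
      _ = Q * Err.card + (Q * R.card * n + (n * (Q * R'.card) + Q * ∑ x, (Blk x).card)) := by
          ring
      _ ≤ n ^ 2 + (3 * s * n * n + (n * (3 * t * n) + s * t * n ^ 2)) := by gcongr
      _ = _ := by ring
  have hlt : Bad.card < U.card := by
    by_contra hcon
    have h1 : (3 * s + 3 * t + s * t + 2) * n ^ 2 ≤ (3 * s + 3 * t + s * t + 1) * n ^ 2 := by
      calc (3 * s + 3 * t + s * t + 2) * n ^ 2
          ≤ (3 * s + 3 * t + s * t + 2) * (N * Bad.card) := by
            gcongr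
            exact hUcard.trans (Nat.mul_le_mul_left _ (not_lt.1 hcon))
        _ = Q * Bad.card := by rw [← hQ]; ring
        _ ≤ _ := hBad
    exact absurd (Nat.le_of_mul_le_mul_right h1 (by positivity)) (by omega)
  obtain ⟨S, hSU, hS⟩ := exists_mem_entries_avoid U hU Bad hlt
  have hSA : ∀ a b, M (S.1 a) (S.2 b) = A a b := fun a b => congrFun (congrFun (hUA hSU) a) b
  have hSErr : ∀ a b, f (i (S.1 a)) (j (S.2 b)) = A a b := by
    intro a b
    by_contra hne
    refine hS a b (Finset.mem_union_left _ (Finset.mem_filter.2 ⟨Finset.mem_univ _, ?_⟩))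
    rw [hSA]
    exact Ne.symm hne
  have hSR : ∀ a, S.1 a ∉ R := fun a h => hS a ⟨0, ht⟩ <| Finset.mem_union_right _ <|
    Finset.mem_union_left _ <| Finset.mem_product.2 ⟨h, Finset.mem_univ _⟩
  have hSR' : ∀ b, S.2 b ∉ R' := fun b h => hS ⟨0, hs⟩ b <| Finset.mem_union_right _ <|
    Finset.mem_union_right _ <| Finset.mem_union_left _ <|
    Finset.mem_product.2 ⟨Finset.mem_univ _, h⟩
  have hSBlk : ∀ a b, (S.1 a, S.2 b) ∉ Blk (a, b) := fun a b h =>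
    hS a b <| Finset.mem_union_right _ <| Finset.mem_union_right _ <| Finset.mem_union_right _ <|
    Finset.mem_biUnion.2 ⟨(a, b), Finset.mem_univ _, h⟩
  have hcount := prod_card_le_two_mul_ncard_copies A M (fun a => B a (g a (S.1 a)))
    (fun b => C b (g' b (S.2 b)))
    (fun ρ hρ => Fin.strictMono_of_lt_next ρ fun a ha =>
      hBord a (by omega) _ _ _ _ (S.1.strictMono (Fin.mk_lt_mk.2 (Nat.lt_succ_self a))) (hSR _)
        (hρ ⟨a, by omega⟩) (hρ ⟨a + 1, ha⟩))
    (fun κ hκ => Fin.strictMono_of_lt_next κ fun b hb =>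
      hCord b (by omega) _ _ _ _ (S.2.strictMono (Fin.mk_lt_mk.2 (Nat.lt_succ_self b))) (hSR' _)
        (hκ ⟨b, by omega⟩) (hκ ⟨b + 1, hb⟩))
    (by
      intro a b
      have h1 := hSBlk a b
      simp only [Blk, Finset.mem_filter, Finset.mem_univ, true_and, not_lt] at h1
      have h2 : ((B a (g a (S.1 a)) ×ˢ C b (g' b (S.2 b))).filter
          fun z => M z.1 z.2 ≠ A a b) ⊆
          Err.filter fun z' => φ (a, b) z' = φ (a, b) (S.1 a, S.2 b) := by
        intro z hz
        simp only [Finset.mem_filter, Finset.mem_product] at hz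
        have hz1 := hBg a _ _ hz.1.1
        have hz2 := hCg b _ _ hz.1.2
        have hi1 : i z.1 = i (S.1 a) := by rw [← hgi a, ← hgi a, hz1]
        have hj1 : j z.2 = j (S.2 b) := by rw [← hgj b, ← hgj b, hz2]
        refine Finset.mem_filter.2 ⟨Finset.mem_filter.2 ⟨Finset.mem_univ _, ?_⟩, ?_⟩
        · rw [hi1, hj1, hSErr]
          exact hz.2
        · exact Prod.ext hz1 hz2
      have h3 : (Finset.univ.filter fun z' => φ (a, b) z' = φ (a, b) (S.1 a, S.2 b)).card =
          (Finset.univ.filter fun r => g a r = g a (S.1 a)).card *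
          (Finset.univ.filter fun c => g' b c = g' b (S.2 b)).card := by
        rw [← Finset.card_product]
        congr 1
        ext z
        simp [φ]
      rw [h3] at h1
      -- The segments may be `Q` times smaller than their classes in each direction, so an error
      -- density in the block can grow by `Q ^ 2`; the threshold in `Blk` contains this factor.
      refine Nat.le_of_mul_le_mul_left ?_ (show 0 < Q ^ 2 by positivity)
      calc Q ^ 2 * (2 * (s * t) * _) = 2 * (s * t) * Q ^ 2 * _ := by ring
        _ ≤ 2 * (s * t) * Q ^ 2 * _ := Nat.mul_le_mul_left _ (Finset.card_le_card h2)
        _ ≤ _ := h1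
        _ ≤ Q * (B a (g a (S.1 a))).card * (Q * (C b (g' b (S.2 b))).card) :=
          Nat.mul_le_mul (hBQ a _) (hCQ b _)
        _ = _ := by ring)
  have hprodB : n ^ s ≤ (K * Q * Q) ^ s * ∏ a : Fin s, (B a (g a (S.1 a))).card := by
    calc n ^ s = ∏ _a : Fin s, n := by simp
      _ ≤ ∏ a : Fin s, (K * Q * Q * (B a (g a (S.1 a))).card) :=
        Finset.prod_le_prod' fun a _ => hBn a a.2 _ (hSR a)
      _ = _ := by rw [Finset.prod_mul_distrib]; simp
  have hprodC : n ^ t ≤ (K * Q * Q) ^ t * ∏ b : Fin t, (C b (g' b (S.2 b))).card := by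
    calc n ^ t = ∏ _b : Fin t, n := by simp
      _ ≤ ∏ b : Fin t, (K * Q * Q * (C b (g' b (S.2 b))).card) :=
        Finset.prod_le_prod' fun b _ => hCn b b.2 _ (hSR' b)
      _ = _ := by rw [Finset.prod_mul_distrib]; simp
  calc n ^ (s + t) = n ^ s * n ^ t := pow_add _ _ _
    _ ≤ _ := Nat.mul_le_mul hprodB hprodC
    _ = (K * Q * Q) ^ (s + t) * ((∏ a : Fin s, (B a (g a (S.1 a))).card) *
        ∏ b : Fin t, (C b (g' b (S.2 b))).card) := by ring
    _ ≤ (K * Q * Q) ^ (s + t) * (2 * (copies A M).ncard) := Nat.mul_le_mul_left _ hcount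
    _ = _ := by ring

/-! ### Degenerate matrices and the conclusion -/

theorem pow_le_mul_card_orderEmbedding {t n : ℕ} (h : t ≤ n) :
    n ^ t ≤ t ^ t * t.factorial * Nat.card (Fin t ↪o Fin n) := by
  classical
  have : Finite (Fin t ↪o Fin n) := DFunLike.finite _
  have h1 : n.choose t ≤ Nat.card (Fin t ↪o Fin n) := by
    have h2 : n.choose t = Nat.card (Finset.powersetCard t (Finset.univ : Finset (Fin n))) := by
      rw [Nat.card_eq_fintype_card, Fintype.card_coe, Finset.card_powersetCard]
      simp
    rw [h2]
    refine Nat.card_le_card_of_injective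
      (fun S => S.1.orderEmbOfFin (Finset.mem_powersetCard.1 S.2).2) fun S S' hSS => ?_
    apply Subtype.ext
    apply Finset.coe_injective
    rw [← Finset.range_orderEmbOfFin S.1 (Finset.mem_powersetCard.1 S.2).2,
      ← Finset.range_orderEmbOfFin S'.1 (Finset.mem_powersetCard.1 S'.2).2]
    exact congrArg (fun e : Fin t ↪o Fin n => Set.range e) hSS
  rcases Nat.eq_zero_or_pos t with rfl | ht
  · simpa using h1
  · have h3 : n ≤ t * (n + 1 - t) := by
      obtain ⟨d, rfl⟩ := Nat.exists_eq_add_of_le h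
      rw [show t + d + 1 - t = d + 1 by omega]
      nlinarith
    calc n ^ t ≤ (t * (n + 1 - t)) ^ t := Nat.pow_le_pow_left h3 t
      _ = t ^ t * (n + 1 - t) ^ t := mul_pow _ _ _
      _ ≤ t ^ t * n.descFactorial t := Nat.mul_le_mul_left _ (Nat.pow_sub_le_descFactorial n t)
      _ = t ^ t * t.factorial * n.choose t := by
          rw [Nat.descFactorial_eq_factorial_mul_choose, mul_assoc]
      _ ≤ _ := Nat.mul_le_mul_left _ h1

/-- The removal lemma with natural parameters. -/
theorem exists_polyBounded_many_copies {s t : ℕ} (A : Matrix (Fin s) (Fin t) (Fin 2)) :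
    ∃ F : ℕ → ℕ, PolyBounded F ∧ ∀ N, 1 ≤ N → ∀ (n : ℕ) (M : Matrix (Fin n) (Fin n) (Fin 2))
      (U : Finset (SubmatrixPos s t n n)), (U : Set (SubmatrixPos s t n n)) ⊆ copies A M →
      (U : Set (SubmatrixPos s t n n)).PairwiseDisjoint SubmatrixPos.entries →
      n ^ 2 ≤ N * U.card → n ^ (s + t) ≤ F N * (copies A M).ncard := by
  classical
  -- If `A` has no entries, every position is a copy, and only the positions have to be counted.
  rcases Nat.eq_zero_or_pos (s * t) with h0 | hpos
  · refine ⟨_, PolyBounded.const (s ^ s * s.factorial * (t ^ t * t.factorial)),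
      fun N hN n M U hUA hU hUcard => ?_⟩
    by_cases hle : s ≤ n ∧ t ≤ n
    · have huniv : copies A M = Set.univ := by
        refine Set.eq_univ_of_forall fun S => ?_
        show M.submatrix _ _ = A
        funext a b
        exact absurd h0 (Nat.mul_pos a.pos b.pos).ne'
      rw [huniv, Set.ncard_univ, Nat.card_prod, pow_add]
      calc _ ≤ _ := Nat.mul_le_mul (pow_le_mul_card_orderEmbedding hle.1)
            (pow_le_mul_card_orderEmbedding hle.2)
        _ = _ := by ring
    · have hUe : U = ∅ := by
        refine Finset.eq_empty_of_forall_notMem fun S _ => hle ⟨?_, ?_⟩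
        · simpa using Fintype.card_le_of_injective _ S.1.injective
        · simpa using Fintype.card_le_of_injective _ S.2.injective
      have hn : n = 0 := by simpa [hUe] using hUcard
      subst hn
      rw [zero_pow (by omega)]
      exact Nat.zero_le _
  obtain ⟨F, hF, h⟩ := many_copies_or_exists_block_approx A
  let Q : ℕ → ℕ := fun N => N * (3 * s + 3 * t + s * t + 2)
  let E : ℕ → ℕ := fun N => 2 * (s * t) * Q N ^ 2 * Q N
  let K : ℕ → ℕ := fun N => (F (E N) + 1) ^ (s + t + 1)
  have hQ : PolyBounded Q := PolyBounded.id.mul (PolyBounded.const _)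
  have hE : PolyBounded E := ((PolyBounded.const _).mul (hQ.pow 2)).mul hQ
  have hK : PolyBounded K := ((hF.comp hE).add (PolyBounded.const 1)).pow _
  refine ⟨fun N => F (E N) + (K N * Q N) ^ (s + t) + 2 * (K N * Q N * Q N) ^ (s + t),
    ((hF.comp hE).add ((hK.mul hQ).pow _)).add
      ((PolyBounded.const 2).mul (((hK.mul hQ).mul hQ).pow _)),
    fun N hN n M U hUA hU hUcard => ?_⟩
  have hs : 0 < s := Nat.pos_of_mul_pos_right hpos
  have ht : 0 < t := Nat.pos_of_mul_pos_left hpos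
  rcases Nat.eq_zero_or_pos n with rfl | hn
  · rw [zero_pow (by omega)]
    exact Nat.zero_le _
  have hQ1 : 1 ≤ Q N := Nat.mul_pos hN (by omega)
  have hE1 : 1 ≤ E N := by
    have : 0 < Q N := hQ1
    have hE0 : 0 < 2 * (s * t) * Q N ^ 2 * Q N := by positivity
    exact hE0
  rcases h (E N) hE1 n M hn with h | ⟨i, j, f, hi, hj, hf⟩
  · refine h.trans (Nat.mul_le_mul_right _ ?_)
    exact (Nat.le_add_right _ _).trans (Nat.le_add_right _ _)
  -- For `n` below `K N * Q N` a single copy suffices, since `n ^ (s + t)` is itself polynomially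
  -- bounded in `N`.
  rcases lt_or_ge n (K N * Q N) with hlt | hge
  · have hcop : 1 ≤ (copies A M).ncard := by
      have hUpos : 0 < U.card := by
        refine Nat.pos_of_ne_zero fun h0 => ?_
        rw [h0, mul_zero] at hUcard
        exact absurd hUcard (not_le.2 (by positivity))
      rw [← Set.ncard_coe_finset] at hUpos
      exact hUpos.trans_le (Set.ncard_le_ncard hUA (copies_finite A M))
    calc n ^ (s + t) ≤ (K N * Q N) ^ (s + t) := Nat.pow_le_pow_left hlt.le _
      _ ≤ F (E N) + (K N * Q N) ^ (s + t) + 2 * (K N * Q N * Q N) ^ (s + t) := by omega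
      _ ≤ _ := Nat.le_mul_of_pos_right _ hcop
  · refine (many_copies_of_block_approx hs ht A M hN rfl rfl hge U hUA hU hUcard i j f hi hj
      hf).trans (Nat.mul_le_mul_right _ (Nat.le_add_left _ _))

theorem mainTheorem1 (s t : ℕ) (A : Matrix (Fin s) (Fin t) (Fin 2)) :
    ∃ P : Polynomial ℝ, ∀ ε : ℝ, 0 < ε →
      ∃ δ : ℝ, 0 < δ ∧ δ⁻¹ = P.eval ε⁻¹ ∧
        ∀ (n : ℕ) (M : Matrix (Fin n) (Fin n) (Fin 2)),
          (∃ U : Finset (SubmatrixPos s t n n),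
            (U : Set (SubmatrixPos s t n n)) ⊆ copies A M ∧
            (U : Set (SubmatrixPos s t n n)).PairwiseDisjoint SubmatrixPos.entries ∧
            ε * (n : ℝ) ^ 2 ≤ (U.card : ℝ)) →
          δ * (n : ℝ) ^ (s + t) ≤ ((copies A M).ncard : ℝ) := by
  obtain ⟨F, ⟨C, k, hF⟩, h⟩ := exists_polyBounded_many_copies A
  -- With `N = ⌈ε⁻¹⌉₊` one has `N + 1 ≤ ε⁻¹ + 2`; `C + 1` in place of `C` keeps the value positive.
  refine ⟨Polynomial.C ((C : ℝ) + 1) * (Polynomial.X + Polynomial.C 2) ^ k, fun ε hε => ?_⟩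
  have hinv : 0 < ε⁻¹ := inv_pos.2 hε
  have hpos : 0 < ((C : ℝ) + 1) * (ε⁻¹ + 2) ^ k := by positivity
  refine ⟨(((C : ℝ) + 1) * (ε⁻¹ + 2) ^ k)⁻¹, inv_pos.2 hpos, by simp, ?_⟩
  rintro n M ⟨U, hUA, hU, hUcard⟩
  have hN1 : 1 ≤ ⌈ε⁻¹⌉₊ := Nat.ceil_pos.2 hinv
  have hNU : n ^ 2 ≤ ⌈ε⁻¹⌉₊ * U.card := by
    have h1 : (n : ℝ) ^ 2 ≤ ⌈ε⁻¹⌉₊ * U.card := by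
      calc (n : ℝ) ^ 2 = ε⁻¹ * (ε * (n : ℝ) ^ 2) := by field_simp
        _ ≤ ε⁻¹ * U.card := by gcongr
        _ ≤ _ := by
          gcongr
          exact Nat.le_ceil _
    exact_mod_cast h1
  have hmain := h ⌈ε⁻¹⌉₊ hN1 n M U hUA hU hNU
  have hFle : (F ⌈ε⁻¹⌉₊ : ℝ) ≤ ((C : ℝ) + 1) * (ε⁻¹ + 2) ^ k := by
    calc (F ⌈ε⁻¹⌉₊ : ℝ) ≤ C * ((⌈ε⁻¹⌉₊ : ℝ) + 1) ^ k := by exact_mod_cast hF _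
      _ ≤ ((C : ℝ) + 1) * (ε⁻¹ + 2) ^ k := by
        have := (Nat.ceil_lt_add_one hinv.le).le
        gcongr ?_ * ?_ ^ k
        · linarith
        · linarith
  rw [inv_mul_le_iff₀ hpos]
  calc (n : ℝ) ^ (s + t) ≤ F ⌈ε⁻¹⌉₊ * ((copies A M).ncard : ℝ) := by exact_mod_cast hmain
    _ ≤ _ := by gcongr
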